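/- Sorting. Let $\pi=\pi_1\cdots\pi_n$ be a permutation of $\{1,\dots,n\}$, waiting in an input list. A deque is a list; at each step one either removes the first element of the input and attaches it to the left or right end of the deque, or removes the left or right end element of the deque and appends it to the output. For two parallel stacks, at each step one either removes the first element of the input and pushes it onto one of the two stacks, or pops the top element of one of the stacks and appends it to the output. $\pi$ is sortable on the deque (resp. on two parallel stacks) if some sequence of steps, starting with empty storage and empty output, ends with the output $1\,2\cdots n$ and empty input and storage. Let $\mathcal D_n$ (resp. $\mathcal C_n$) be the set of permutations of length $n$ that are sortable on a deque (resp. on two parallel stacks). r-twinstacks. An r-twinstack is a finite binary string $S=s_0s_1\cdots s_{|S|-1}$ (where $s_i=1$ means that the $(i+1)$-st smallest element lies in the left stack, and $s_i=0$ that it lies in the right stack). It is one-sided if all its entries are equal (in particular if it is empty), and monotonic if all its entries except possibly the last one are equal. Write $()$ for the empty r-twinstack and $(\bullet)$ for the string $1$. For $j\ge 0$ and $b\in\{0,1\}$, the list $T(S,j,b)$ of r-twinstacks reachable from $S$ with signal $j$ given $b$ is the following. * If $j>0$: let $z$ be the index of the first $0$ in $S$ ($z=|S|$ if there is none). For each $i=1,\dots,z$,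 the list contains the string obtained from $S$ by inserting a $0$ at index $i$, changing the last entry to $1$ if $b=1$ and $i=|S|$, and then prepending $j-1$ ones. * If $j=0$: for each $i=0,\dots,|S|$, the list contains the string $X$ obtained from $S$ by deleting its first $i$ entries, complementing all entries if the first remaining entry is $0$, and then, if $b=1$, $X$ is not empty and $|S|-i$ is at most the length of the longest monotonic postfix of $S$, changing the last entry to $1$. The recursion. For an r-twinstack $S$ and an integer $k\ge 0$ put $k'(S,k)=0$ if $k=0$; $k'(S,k)=k-|S|$ if $S$ is one-sided and $0\le|S|<k$; and $k'(S,k)=-1$ otherwise. For $m\ge 1$, $k\ge 0$, $b\in\{0,1\}$ define $h(S,m,k,b)$ by $$h(S,1,k,b)=\begin{cases}1&\text{if }k=0\text{, or if }S\text{ is one-sided and }|S|=k-1,\\0&\text{otherwise,}\end{cases}$$ and, for $m>1$, by $$h((),m,k,b)=h((\bullet),m-1,k,b)+h((),m-1,k,b)$$ and, for $S\neq()$, $$h(S,m,k,b)=\sum_{i=1}^{m-1}\sum_{j=0}^{i+1}h((),i,j,0)\sum_{\substack{S'\in T(S,j,b)\\S'\ne S}}h(S',m-i,k,b)\;+\;h((\bullet),m-1,k',0)+h((),m-1,k',0),$$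 where $k'=k'(S,k)$ and the last two terms are omitted if $k'=-1$. Let Relativistic-Histories$(S,m,k,b)$ be the memoized recursive procedure that evaluates this recursion: it first looks up the key $(S,m,k,b)$ in a global dictionary and returns the stored value if there is one; otherwise it computes the right-hand side through recursive calls, stores the result under that key and returns it. Let Relativistic-Sortable-Count$(n,b)$ return Relativistic-Histories$((),n,0,b)$, starting with an empty dictionary. Theorem. For every $n\ge 1$, $$h((),n,0,1)=|\mathcal D_n|\qquad\text{and}\qquad h((),n,0,0)=|\mathcal C_n|,$$ and Relativistic-Sortable-Count is correct: Relativistic-Sortable-Count$(n,1)$ returns $|\mathcal D_n|$ and Relativistic-Sortable-Count$(n,0)$ returns $|\mathcal C_n|$. -/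

import Mathlib

namespace SwitchyardSorting

/-! ### Sorting on a deque and on two parallel stacks -/

/-- A state of a switchyard network holding the elements `0, …, n - 1`: the output list (in the
order in which the elements were output), the contents of the storage elements, and the input
list (next element first). -/
structure NetState (n : ℕ) (Storage : Type) where
  output : List (Fin n)
  storage : Storage
  input : List (Fin n)

/-- One step on a deque, whose content is listed from left to right. -/
inductive DequeStep {n : ℕ} : NetState n (List (Fin n)) → NetState n (List (Fin n)) → Prop
  | pushLeft (o d i : List (Fin n)) (x : Fin n) : DequeStep ⟨o, d, x :: i⟩ ⟨o, x :: d, i⟩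
  | pushRight (o d i : List (Fin n)) (x : Fin n) : DequeStep ⟨o, d, x :: i⟩ ⟨o, d ++ [x], i⟩
  | popLeft (o d i : List (Fin n)) (x : Fin n) : DequeStep ⟨o, x :: d, i⟩ ⟨o ++ [x], d, i⟩
  | popRight (o d i : List (Fin n)) (x : Fin n) : DequeStep ⟨o, d ++ [x], i⟩ ⟨o ++ [x], d, i⟩

/-- One step on two parallel stacks `(L, R)`, each listed from top to bottom. -/
inductive ParallelStep {n : ℕ} :
    NetState n (List (Fin n) × List (Fin n)) → NetState n (List (Fin n) × List (Fin n)) → Prop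
  | pushLeft (o l r i : List (Fin n)) (x : Fin n) :
      ParallelStep ⟨o, (l, r), x :: i⟩ ⟨o, (x :: l, r), i⟩
  | pushRight (o l r i : List (Fin n)) (x : Fin n) :
      ParallelStep ⟨o, (l, r), x :: i⟩ ⟨o, (l, x :: r), i⟩
  | popLeft (o l r i : List (Fin n)) (x : Fin n) :
      ParallelStep ⟨o, (x :: l, r), i⟩ ⟨o ++ [x], (l, r), i⟩
  | popRight (o l r i : List (Fin n)) (x : Fin n) :
      ParallelStep ⟨o, (l, x :: r), i⟩ ⟨o ++ [x], (l, r), i⟩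

/-- `π`, read as the word `π 0, π 1, …, π (n - 1)`, can be sorted on a deque: some run leads from
the state with `π` in the input to the state with `0, 1, …, n - 1` in the output. -/
def DequeSortable {n : ℕ} (π : Equiv.Perm (Fin n)) : Prop :=
  Relation.ReflTransGen DequeStep ⟨[], [], List.ofFn π⟩ ⟨List.finRange n, [], []⟩

/-- `π` can be sorted on two parallel stacks. -/
def ParallelSortable {n : ℕ} (π : Equiv.Perm (Fin n)) : Prop :=
  Relation.ReflTransGen ParallelStep ⟨[], ([], []), List.ofFn π⟩ ⟨List.finRange n, ([], []), []⟩

/-- The deque-sortable permutations of length `n`. -/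
def dequeClass (n : ℕ) : Set (Equiv.Perm (Fin n)) := {π | DequeSortable π}

/-- The permutations of length `n` that are sortable on two parallel stacks. -/
def parallelClass (n : ℕ) : Set (Equiv.Perm (Fin n)) := {π | ParallelSortable π}

/-! ### r-twinstacks and their transitions -/

/-- An r-twinstack: the entry at index `i` is `true` iff the `i`-th smallest element is in the left
stack. -/
abbrev RTwinstack := List Bool

/-- At least one of the two stacks is empty. -/
def RTwinstack.oneSided (S : RTwinstack) : Bool :=
  S.all (fun x => x == true) || S.all (fun x => x == false)

/-- All elements except possibly the largest one lie in the same stack. -/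
def RTwinstack.monotonic (S : RTwinstack) : Bool := RTwinstack.oneSided S.dropLast

/-- The size of the largest monotonic postfix. -/
def RTwinstack.maxMonotonicPostfix (S : RTwinstack) : ℕ :=
  Nat.findGreatest (fun t => RTwinstack.monotonic (S.drop (S.length - t)) = true) S.length

/-- Move the largest element to the left stack. -/
def RTwinstack.setLastLeft (S : RTwinstack) : RTwinstack := S.set (S.length - 1) true

/-- Reverse the r-twinstack if its smallest element is in the right stack. -/
def RTwinstack.orient (S : RTwinstack) : RTwinstack :=
  if S.head? = some false then S.map not else S

/-- Get-R-Twinstack-Transition-List: the r-twinstacks reachable from `S` on reception of the signal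
`j`, with the transition rules of a bottom r-twinstack if `b = true` and those of a non-bottom
r-twinstack if `b = false`. -/
def transitionList (S : RTwinstack) (j : ℕ) (b : Bool) : List RTwinstack :=
  if 0 < j then
    -- the index of the first `false`, which is `S.length` if there is none
    let z := S.findIdx (fun x => x == false)
    (List.range' 1 z).map fun i =>
      let X := S.insertIdx i false
      let X := if b = true ∧ i = S.length then RTwinstack.setLastLeft X else X
      List.replicate (j - 1) true ++ X
  else
    (List.range (S.length + 1)).map fun i =>
      let X := RTwinstack.orient (S.drop i)
      if b = true ∧ S.length - i ≤ RTwinstack.maxMonotonicPostfix S ∧ X ≠ [] then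
        RTwinstack.setLastLeft X
      else X

/-- The unique signal which, received by an epoch with nonempty r-twinstack `S`, makes it send the
signal `k`; `none` if there is no such signal. -/
def getKPrime (S : RTwinstack) (k : ℕ) : Option ℕ :=
  if k = 0 then some 0
  else if RTwinstack.oneSided S = true ∧ S.length < k then some (k - S.length)
  else none

/-- The value for a single step. -/
def baseValue (S : RTwinstack) (k : ℕ) : ℕ :=
  if k = 0 ∨ (S.length = k - 1 ∧ RTwinstack.oneSided S = true) then 1 else 0

/-! ### The recursion and the memoized procedure -/

/-- The recursive function `h(S, m, k, b)` on r-twinstacks `S`, step counts `m ≥ 1`, signals `k`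
and bottom-level flags `b`. The value at `m = 0` is a dummy which no value at `m ≥ 1` uses. -/
def h (S : RTwinstack) (m k : ℕ) (b : Bool) : ℕ :=
  match m with
  | 0 => 0
  | 1 => baseValue S k
  | m + 2 =>
    if S = [] then h [true] (m + 1) k b + h [] (m + 1) k b
    else
      (match getKPrime S k with
        | none => 0
        | some k' => h [true] (m + 1) k' false + h [] (m + 1) k' false) +
      -- `i + 1` is the number of steps after which `S` first changes
      ∑ i : Fin (m + 1), ∑ j ∈ Finset.range (i.val + 3),
        h [] (i.val + 1) j false *
          (((transitionList S j b).filter (fun S' => S' ≠ S)).map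
            (fun S' => h S' (m + 2 - (i.val + 1)) k b)).sum
termination_by m
decreasing_by all_goals omega

/-- The memoization dictionary: the value stored for each key, if any. -/
abbrev Dictionary := RTwinstack × ℕ × ℕ × Bool → Option ℕ

/-- Relativistic-Histories, the memoized procedure, which reads and updates a global dictionary.
The case `m = 0` is a dummy which no call with `m ≥ 1` reaches. -/
def relativisticHistories (S : RTwinstack) (m k : ℕ) (b : Bool) : StateM Dictionary ℕ := do
  let dictionary ← get
  match dictionary (S, m, k, b) with
  | some v => return v
  | none =>
    let result ←
      match m with
      | 0 => pure 0
      | 1 => pure (baseValue S k)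
      | m + 2 =>
        if S = [] then do
          let u ← relativisticHistories [true] (m + 1) k b
          let v ← relativisticHistories [] (m + 1) k b
          pure (u + v)
        else do
          let r ←
            match getKPrime S k with
            | none => pure 0
            | some k' => do
              let u ← relativisticHistories [true] (m + 1) k' false
              let v ← relativisticHistories [] (m + 1) k' false
              pure (u + v)
          (List.finRange (m + 1)).foldlM (fun r i =>
            (List.range (i.val + 3)).foldlM (fun r j =>
              (transitionList S j b).foldlM (fun r S' =>
                if S' = S then pure r
                else do
                  let u ← relativisticHistories [] (i.val + 1) j false
                  let v ← relativisticHistories S' (m + 2 - (i.val + 1)) k b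
                  pure (r + u * v)) r) r) r
    modify fun dictionary => Function.update dictionary (S, m, k, b) (some result)
    return result
termination_by m
decreasing_by all_goals omega

/-- Relativistic-Sortable-Count: the value returned when the dictionary is initially empty. -/
def relativisticSortableCount (n : ℕ) (b : Bool) : ℕ :=
  if b = true then ((relativisticHistories [] n 0 true).run (fun _ => none)).1
  else ((relativisticHistories [] n 0 false).run (fun _ => none)).1

end SwitchyardSorting

namespace SwitchyardSorting

/-! ### Piles of r-twinstacks -/

/-! Outputting every element as early as possible never hurts, so sorting on a deque reduces to
choosing a side for each input element (`dequeSortable_iff`). A deque content that can be output in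
increasing order is described by its elements in increasing order and one bit each, telling whether
the element lies left or right of all larger ones (`lay`); the bit of the largest element is
irrelevant. A new element may be attached on side `c` exactly when all smaller stored elements have
bit `!c`, up to that irrelevant bit.

Instead of one choice of sides, follow the set of all bit strings that some choice can produce. It
is always a product: the elements split into consecutive blocks, the string on each block is fixed
up to complement, and the last bit of the bottom block is free. A pile of r-twinstacks encodes such
a set (`Pile.Places`). A new smallest element starts a new block. An element larger than a whole
upper pile `A` and than `i ≥ 1` elements of the block `S` below it forces these elements to one
side: `A` must be one-sided, and `A`, `S` and the new element merge into one block. Output truncates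
the strings. So the pile depends only on the history, that is, on the rank of each new element and
the number of outputs after it, and sortability means that the history can be carried out from the
empty pile (`exists_greedySortable_iff_admits`). Permutations and histories correspond, since a
history determines its permutation and there are `n!` of each (`ncard_eq_countP`).

Two parallel stacks are a deque that initially holds an extra largest element, which separates the
stacks and is output last. This element is the bottom block, so whatever lies above it has no free
bit: this is the case `b = false`.

The recursion splits a run from `S :: A` at the first step that changes `S`. Up to that step the run
is one of `A` under non-bottom rules, and `S` only receives a signal: `0` when all of `A` and part
of `S` are output, or `Pile.size A + 1` when a one-sided `A` is merged with the new element into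
`S`. Afterwards at most one r-twinstack is left, which closes the recursion (`count_cons`,
`h_eq_count`). Memoization preserves the invariant that stored values are correct. -/

/-- The transition of `S` in which its `i` smallest elements are output. -/
def RTwinstack.popped (S : RTwinstack) (b : Bool) (i : ℕ) : RTwinstack :=
  if b = true ∧ S.length - i ≤ RTwinstack.maxMonotonicPostfix S ∧
      RTwinstack.orient (S.drop i) ≠ [] then
    RTwinstack.setLastLeft (RTwinstack.orient (S.drop i))
  else RTwinstack.orient (S.drop i)

/-- The transition of `S` in which `S` receives `j` elements from above, the largest of which is
larger than exactly `i` elements of `S`. -/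
def RTwinstack.merged (S : RTwinstack) (b : Bool) (j i : ℕ) : RTwinstack :=
  List.replicate (j - 1) true ++
    (if b = true ∧ i = S.length then RTwinstack.setLastLeft (S.insertIdx i false)
      else S.insertIdx i false)

/-- The number of smallest elements that lie in the left stack. -/
def RTwinstack.leftRun (S : RTwinstack) : ℕ := S.findIdx (fun x => x == false)

theorem transitionList_zero (S : RTwinstack) (b : Bool) :
    transitionList S 0 b = (List.range (S.length + 1)).map (RTwinstack.popped S b) := rfl

theorem transitionList_succ (S : RTwinstack) (j : ℕ) (b : Bool) :
    transitionList S (j + 1) b =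
      (List.range' 1 (RTwinstack.leftRun S)).map (RTwinstack.merged S b (j + 1)) := by
  simp [transitionList, RTwinstack.merged, RTwinstack.leftRun]

/-- A pile of r-twinstacks, listed from bottom to top; the elements of an r-twinstack are larger
than those of the r-twinstacks above it. -/
abbrev Pile := List RTwinstack

/-- The number of elements in a pile. -/
def Pile.size (P : Pile) : ℕ := (P.map List.length).sum

/-- Every r-twinstack of the pile is one-sided. -/
def Pile.OneSided (P : Pile) : Prop := ∀ S ∈ P, RTwinstack.oneSided S = true

instance (P : Pile) : Decidable (Pile.OneSided P) :=
  inferInstanceAs (Decidable (∀ S ∈ P, RTwinstack.oneSided S = true))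

/-- The pile consisting of one r-twinstack, which is dropped if it is empty. -/
def RTwinstack.pile (S : RTwinstack) : Pile := if S = [] then [] else [S]

/-- Push an element that is larger than exactly `r` elements of the pile, if this is possible. -/
def Pile.push : Bool → Pile → ℕ → Option Pile
  | _, [], _ => some [[true]]
  | b, S :: A, r =>
    if r ≤ Pile.size A then (Pile.push false A r).map (S :: ·)
    else if Pile.OneSided A ∧ r - Pile.size A ≤ RTwinstack.leftRun S then
      some [RTwinstack.merged S b (Pile.size A + 1) (r - Pile.size A)]
    else none

/-- Output the `p` smallest elements of a pile. -/
def Pile.pop : Bool → Pile → ℕ → Pile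
  | _, [], _ => []
  | b, S :: A, p =>
    if p ≤ Pile.size A then S :: Pile.pop false A p
    else RTwinstack.pile (RTwinstack.popped S b (p - Pile.size A))

/-- The piles reachable in one step: either an element is pushed and nothing is output, or a new
smallest element and a number of elements of the pile are output. -/
def Pile.steps (b : Bool) (P : Pile) : List Pile :=
  (List.range (Pile.size P + 1)).filterMap (Pile.push b P) ++
    (List.range (Pile.size P + 1)).map (Pile.pop b P)

/-- A pile can send the signal `k` to an r-twinstack below it. -/
def Pile.Signals (P : Pile) (k : ℕ) : Prop := k = 0 ∨ (Pile.OneSided P ∧ k = Pile.size P + 1)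

instance (P : Pile) (k : ℕ) : Decidable (Pile.Signals P k) :=
  inferInstanceAs (Decidable (_ ∨ _))

/-- The number of ways to make `m` steps from a pile, the last of which sends the signal `k`. -/
def Pile.count (b : Bool) (k : ℕ) : ℕ → Pile → ℕ
  | 0, _ => 0
  | 1, P => if Pile.Signals P k then 1 else 0
  | m + 2, P => ((Pile.steps b P).map (Pile.count b k (m + 1))).sum

/-- The r-twinstacks that occur: the smallest element is on the left, and in a bottom r-twinstack
the largest element joins the others if these are all in one stack. -/
structure RTwinstack.Canonical (b : Bool) (S : RTwinstack) : Prop where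
  head : S.head? = some true
  last : b = true → RTwinstack.monotonic S = true → ∀ x ∈ S, x = true

/-! ### Sizes of piles, and transitions that change an r-twinstack. -/

@[simp] theorem Pile.size_nil : Pile.size [] = 0 := rfl

@[simp] theorem Pile.size_cons (S : RTwinstack) (A : Pile) :
    Pile.size (S :: A) = S.length + Pile.size A := by
  simp [Pile.size]

theorem RTwinstack.size_pile (S : RTwinstack) : Pile.size (RTwinstack.pile S) = S.length := by
  unfold RTwinstack.pile
  split_ifs with hS <;> simp [hS]

@[simp] theorem RTwinstack.length_setLastLeft (S : RTwinstack) :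
    (RTwinstack.setLastLeft S).length = S.length := by
  simp [RTwinstack.setLastLeft]

@[simp] theorem RTwinstack.length_orient (S : RTwinstack) :
    (RTwinstack.orient S).length = S.length := by
  unfold RTwinstack.orient
  split_ifs <;> simp

theorem RTwinstack.length_popped (S : RTwinstack) (b : Bool) (i : ℕ) :
    (RTwinstack.popped S b i).length = S.length - i := by
  unfold RTwinstack.popped
  split_ifs <;> simp

theorem RTwinstack.leftRun_le_length (S : RTwinstack) : RTwinstack.leftRun S ≤ S.length :=
  List.findIdx_le_length

theorem RTwinstack.length_merged {S : RTwinstack} (b : Bool) (j : ℕ) {i : ℕ} (hi : i ≤ S.length) :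
    (RTwinstack.merged S b (j + 1) i).length = j + S.length + 1 := by
  unfold RTwinstack.merged
  split_ifs <;> simp [List.length_insertIdx_of_le_length hi] <;> omega

theorem Pile.size_push {b : Bool} {P P' : Pile} {r : ℕ} (hr : r ≤ Pile.size P)
    (h : Pile.push b P r = some P') : Pile.size P' = Pile.size P + 1 := by
  induction P generalizing b P' with
  | nil =>
    obtain rfl : [[true]] = P' := by simpa [Pile.push] using h
    simp
  | cons S A ih =>
    rw [Pile.push] at h
    split_ifs at h with h1 h2
    · obtain ⟨A', hA, rfl⟩ := Option.map_eq_some_iff.1 h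
      simp [ih h1 hA]; omega
    · obtain rfl := Option.some.inj h
      rw [Pile.size_cons] at hr
      simp [RTwinstack.length_merged b (Pile.size A)
        (show r - Pile.size A ≤ S.length by omega)]; omega

theorem Pile.size_pop (b : Bool) (P : Pile) (p : ℕ) :
    Pile.size (Pile.pop b P p) = Pile.size P - p := by
  induction P generalizing b with
  | nil => simp [Pile.pop]
  | cons S A ih =>
    rw [Pile.pop]
    split_ifs with h1
    · simp [ih]; omega
    · simp [RTwinstack.size_pile, RTwinstack.length_popped]; omega

theorem Pile.size_le_of_mem_steps {b : Bool} {P P' : Pile} (h : P' ∈ Pile.steps b P) :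
    Pile.size P' ≤ Pile.size P + 1 := by
  rw [Pile.steps, List.mem_append, List.mem_filterMap, List.mem_map] at h
  rcases h with ⟨r, hr, h⟩ | ⟨q, _, rfl⟩
  · rw [Pile.size_push (by simpa [Nat.lt_succ_iff] using hr) h]
  · rw [Pile.size_pop]; omega

theorem RTwinstack.monotonic_of_length_le {S : RTwinstack}
    (h : S.length ≤ RTwinstack.maxMonotonicPostfix S) : RTwinstack.monotonic S = true := by
  have hle : RTwinstack.maxMonotonicPostfix S ≤ S.length := Nat.findGreatest_le _
  have hs : RTwinstack.monotonic (S.drop (S.length - RTwinstack.maxMonotonicPostfix S)) = true :=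
    Nat.findGreatest_spec (P := fun t => RTwinstack.monotonic (S.drop (S.length - t)) = true)
      (Nat.zero_le _) (by simp [RTwinstack.monotonic, RTwinstack.oneSided])
  simpa [show S.length - RTwinstack.maxMonotonicPostfix S = 0 by omega] using hs

theorem RTwinstack.setLastLeft_eq_self {S : RTwinstack} (h : ∀ x ∈ S, x = true) :
    RTwinstack.setLastLeft S = S := by
  obtain ⟨n, rfl⟩ : ∃ n, S = List.replicate n true := ⟨_, List.eq_replicate_of_mem h⟩
  apply List.ext_getElem (by simp)
  intro i h1 h2
  simp [RTwinstack.setLastLeft]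

/-- The normal form makes the empty transition literally the identity: if the rule for the largest
element applies to all of `S`, then `S` is monotonic, hence already all ones. So the filter `S' ≠ S`
can recognize this transition. -/
theorem RTwinstack.Canonical.popped_zero {b : Bool} {S : RTwinstack}
    (h : RTwinstack.Canonical b S) : RTwinstack.popped S b 0 = S := by
  have ho : RTwinstack.orient S = S := by simp [RTwinstack.orient, h.head]
  simp only [RTwinstack.popped, List.drop_zero, ho, Nat.sub_zero]
  split_ifs with hc
  · exact RTwinstack.setLastLeft_eq_self (h.last hc.1 (RTwinstack.monotonic_of_length_le hc.2.1))
  · rfl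

/-- The sum of a function over the transitions that change `S`. -/
def transitionSum (b : Bool) (S : RTwinstack) (j : ℕ) (g : RTwinstack → ℕ) : ℕ :=
  (((transitionList S j b).filter (fun S' => S' ≠ S)).map g).sum

/-- All choices `i ≥ 1` shorten `S`, so the filter discards `i = 0` and nothing else. -/
theorem transitionSum_zero {b : Bool} {S : RTwinstack} (h : RTwinstack.Canonical b S)
    (g : RTwinstack → ℕ) : transitionSum b S 0 g =
      ((List.range' 1 S.length).map (fun i => g (RTwinstack.popped S b i))).sum := by
  rw [transitionSum, transitionList_zero, List.range_eq_range', List.range'_succ, List.map_cons,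
    h.popped_zero, List.filter_cons_of_neg (by simp), List.filter_eq_self.2, List.map_map]
  · rfl
  · intro X hX
    obtain ⟨i, hi, rfl⟩ := List.mem_map.1 hX
    rw [List.mem_range'_1] at hi
    have := RTwinstack.length_popped S b i
    simp only [ne_eq, decide_eq_true_eq]
    intro he
    rw [he] at this
    omega

/-- A merge lengthens `S`, so here the filter discards nothing. -/
theorem transitionSum_succ (b : Bool) (S : RTwinstack) (j : ℕ) (g : RTwinstack → ℕ) :
    transitionSum b S (j + 1) g = ((List.range' 1 (RTwinstack.leftRun S)).map
      (fun i => g (RTwinstack.merged S b (j + 1) i))).sum := by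
  rw [transitionSum, transitionList_succ, List.filter_eq_self.2, List.map_map]
  · rfl
  · intro X hX
    obtain ⟨i, hi, rfl⟩ := List.mem_map.1 hX
    rw [List.mem_range'_1] at hi
    have := RTwinstack.length_merged (S := S) b j (i := i)
      (by have := RTwinstack.leftRun_le_length S; omega)
    simp only [ne_eq, decide_eq_true_eq]
    intro he
    rw [he] at this
    omega

theorem RTwinstack.pile_merged {S : RTwinstack} (b : Bool) (j : ℕ) {i : ℕ} (hi : i ≤ S.length) :
    RTwinstack.pile (RTwinstack.merged S b (j + 1) i) = [RTwinstack.merged S b (j + 1) i] := by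
  have := RTwinstack.length_merged b j hi
  rw [RTwinstack.pile, if_neg]
  intro h0
  simp [h0] at this

theorem range_add_add_one (a s : ℕ) :
    List.range (s + a + 1) = List.range (a + 1) ++ (List.range' 1 s).map (a + ·) := by
  rw [show s + a + 1 = (a + 1) + s by omega, List.range_add, List.range'_eq_map_range, List.map_map]
  congr 2
  funext x
  simp; omega

theorem filterMap_push_cons (b : Bool) (S : RTwinstack) (A : Pile) :
    (List.range (Pile.size (S :: A) + 1)).filterMap (Pile.push b (S :: A)) =
      ((List.range (Pile.size A + 1)).filterMap (Pile.push false A)).map (S :: ·) ++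
      if Pile.OneSided A then (List.range' 1 (RTwinstack.leftRun S)).map
        (fun i => RTwinstack.pile (RTwinstack.merged S b (Pile.size A + 1) i)) else [] := by
  have hz := RTwinstack.leftRun_le_length S
  rw [Pile.size_cons, range_add_add_one, List.filterMap_append, List.map_filterMap]
  congr 1
  · apply List.filterMap_congr
    intro r hr
    rw [Pile.push, if_pos (by simpa [Nat.lt_succ_iff] using hr)]
  -- Ranks beyond `Pile.size A + RTwinstack.leftRun S` would need both sides to be clear, so they
  -- contribute nothing.
  · rw [List.filterMap_map,
      show S.length = RTwinstack.leftRun S + (S.length - RTwinstack.leftRun S) by omega,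
      ← List.range'_append_1, List.filterMap_append]
    have hright : (List.range' (1 + RTwinstack.leftRun S)
        (S.length - RTwinstack.leftRun S)).filterMap
        (Pile.push b (S :: A) ∘ (Pile.size A + ·)) = [] := by
      rw [List.filterMap_eq_nil_iff]
      intro i hi
      rw [List.mem_range'_1] at hi
      simp only [Function.comp_apply]
      rw [Pile.push, if_neg (by omega), if_neg (by omega)]
    rw [hright, List.append_nil]
    split_ifs with hA
    · rw [← List.filterMap_eq_map]
      apply List.filterMap_congr
      intro i hi
      rw [List.mem_range'_1] at hi
      simp only [Function.comp_apply]
      rw [Pile.push, if_neg (by omega), if_pos ⟨hA, by omega⟩, Nat.add_sub_cancel_left,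
        RTwinstack.pile_merged b _ (by omega)]
    · rw [List.filterMap_eq_nil_iff]
      intro i hi
      rw [List.mem_range'_1] at hi
      simp only [Function.comp_apply]
      rw [Pile.push, if_neg (by omega), if_neg (by tauto)]

theorem map_pop_cons (b : Bool) (S : RTwinstack) (A : Pile) :
    (List.range (Pile.size (S :: A) + 1)).map (Pile.pop b (S :: A)) =
      ((List.range (Pile.size A + 1)).map (Pile.pop false A)).map (S :: ·) ++
      (List.range' 1 S.length).map (fun i => RTwinstack.pile (RTwinstack.popped S b i)) := by
  rw [Pile.size_cons, range_add_add_one, List.map_append, List.map_map, List.map_map]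
  congr 1
  · apply List.map_congr_left
    intro r hr
    rw [Pile.pop, if_pos (by simpa [Nat.lt_succ_iff] using hr)]
    rfl
  · apply List.map_congr_left
    intro i hi
    rw [List.mem_range'_1] at hi
    simp only [Function.comp_apply]
    rw [Pile.pop, if_neg (by omega), Nat.add_sub_cancel_left]

/-- A step on `S :: A` is a step above `S`, or a transition of `S` on a signal sent by `A`. -/
theorem sum_steps_cons {b : Bool} {S : RTwinstack} (hS : RTwinstack.Canonical b S) (A : Pile)
    (g : Pile → ℕ) {J : ℕ} (hJ : Pile.size A + 2 ≤ J) :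
    ((Pile.steps b (S :: A)).map g).sum =
      ((Pile.steps false A).map (fun A' => g (S :: A'))).sum +
      ∑ j ∈ Finset.range J, (if Pile.Signals A j then 1 else 0) *
        transitionSum b S j (fun S' => g (RTwinstack.pile S')) := by
  -- Only the signals `0` and `Pile.size A + 1` occur; the bound on `J` puts both in the range.
  have hsum : ∑ j ∈ Finset.range J, (if Pile.Signals A j then 1 else 0) *
        transitionSum b S j (fun S' => g (RTwinstack.pile S')) =
      transitionSum b S 0 (fun S' => g (RTwinstack.pile S')) +
        if Pile.OneSided A then
          transitionSum b S (Pile.size A + 1) (fun S' => g (RTwinstack.pile S')) else 0 := by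
    obtain ⟨J, rfl⟩ : ∃ J', J = J' + 1 := ⟨J - 1, by omega⟩
    rw [Finset.sum_range_succ', add_comm]
    congr 1
    · simp [Pile.Signals]
    · rw [Finset.sum_eq_single_of_mem (Pile.size A) (by simp; omega)]
      · simp [Pile.Signals]
      · intro j _ hj
        simp [Pile.Signals, hj]
  rw [hsum, transitionSum_zero hS, transitionSum_succ, Pile.steps, Pile.steps, filterMap_push_cons,
    map_pop_cons]
  split_ifs <;> simp [List.map_append, List.sum_append, List.map_map, Function.comp_def] <;> ring

theorem sum_map_finset_sum {α ι : Type*} (l : List α) (s : Finset ι) (f : ι → α → ℕ) :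
    (l.map (fun a => ∑ i ∈ s, f i a)).sum = ∑ i ∈ s, (l.map (f i)).sum := by
  induction l with
  | nil => simp
  | cons a l ih => simp [ih, Finset.sum_add_distrib]

/-- A nonzero signal counts the elements of a one-sided pile and the new one, so passing through a
one-sided `S` adds `S.length` to it. -/
theorem signals_cons (S : RTwinstack) (A : Pile) (k : ℕ) :
    (if Pile.Signals (S :: A) k then 1 else 0) = match getKPrime S k with
      | none => 0
      | some k' => if Pile.Signals A k' then 1 else 0 := by
  unfold getKPrime
  by_cases hk : k = 0
  · simp [hk, Pile.Signals]
  · by_cases hc : RTwinstack.oneSided S = true ∧ S.length < k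
    · simp only [hk, if_false, hc, and_self, if_true]
      refine if_congr ?_ rfl rfl
      simp only [Pile.Signals, Pile.OneSided, List.mem_cons, forall_eq_or_imp, hc.1, true_and, hk,
        false_or, Pile.size_cons]
      have := hc.2
      constructor
      · rintro ⟨h1, h2⟩; exact Or.inr ⟨h1, by omega⟩
      · rintro (h1 | ⟨h1, h2⟩)
        · omega
        · exact ⟨h1, by omega⟩
    · simp only [hk, if_false, hc]
      rw [if_neg]
      simp only [Pile.Signals, Pile.OneSided, List.mem_cons, forall_eq_or_imp, hk, false_or,
        Pile.size_cons]
      rintro ⟨⟨h1, _⟩, h2⟩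
      exact hc ⟨h1, by omega⟩

/-- Decomposition of the runs from `S :: A` by the first step that changes `S`. -/
theorem count_cons {b : Bool} {S : RTwinstack} (hS : RTwinstack.Canonical b S) (k J m : ℕ)
    (A : Pile) (hJ : Pile.size A + m + 1 ≤ J) :
    Pile.count b k (m + 1) (S :: A) =
      (match getKPrime S k with
        | none => 0
        | some k' => Pile.count false k' (m + 1) A) +
      ∑ i ∈ Finset.range m, ∑ j ∈ Finset.range J, Pile.count false j (i + 1) A *
        transitionSum b S j (fun S' => Pile.count b k (m - i) (RTwinstack.pile S')) := by
  -- One bound `J` serves throughout: a step enlarges the pile by at most one while `m` drops by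
  -- one.
  induction m generalizing A with
  | zero =>
    simp only [Pile.count, Finset.range_zero, Finset.sum_empty, add_zero]
    exact signals_cons S A k
  | succ m ih =>
    have hih : (Pile.steps false A).map (fun A' => Pile.count b k (m + 1) (S :: A')) =
        (Pile.steps false A).map (fun A' => (match getKPrime S k with
          | none => 0
          | some k' => Pile.count false k' (m + 1) A') +
          ∑ i ∈ Finset.range m, ∑ j ∈ Finset.range J, Pile.count false j (i + 1) A' *
          transitionSum b S j (fun S' => Pile.count b k (m - i) (RTwinstack.pile S'))) := by
      apply List.map_congr_left
      intro A' hA'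
      exact ih A' (by have := Pile.size_le_of_mem_steps hA'; omega)
    -- Splitting off `i = 0` isolates the runs whose very first step changes `S`; the other summands
    -- come from the induction hypothesis after a step above `S`.
    rw [Pile.count, sum_steps_cons hS A _ (J := J) (by omega), hih, List.sum_map_add,
      Finset.sum_range_succ', sum_map_finset_sum, add_assoc]
    congr 1
    · cases getKPrime S k with
      | none => simp
      | some k' => rfl
    · congr 1
      refine Finset.sum_congr rfl fun i _ => ?_
      rw [sum_map_finset_sum]
      refine Finset.sum_congr rfl fun j _ => ?_
      rw [List.sum_map_mul_right, Pile.count, Nat.add_sub_add_right]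

/-- A pile gains at most one element per step, and a nonzero signal exceeds the size by one. This
makes the truncation of the sum over signals harmless. -/
theorem count_eq_zero (b : Bool) {j m : ℕ} {P : Pile} (h : Pile.size P + m < j) :
    Pile.count b j m P = 0 := by
  induction m using Nat.strong_induction_on generalizing P with
  | _ m ih =>
  match m, ih, h with
  | 0, _, _ => rfl
  | 1, _, h =>
    rw [Pile.count, if_neg]
    unfold Pile.Signals
    omega
  | m + 2, ih, h =>
    rw [Pile.count]
    apply List.sum_eq_zero
    intro x hx
    obtain ⟨P', hP', rfl⟩ := List.mem_map.1 hx
    exact ih (m + 1) (by omega) (by have := Pile.size_le_of_mem_steps hP'; omega)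

/-! ### Canonical r-twinstacks -/

theorem insertIdx_eq_take_append_cons_drop {α : Type*} (a : α) : ∀ (l : List α) {i : ℕ},
    i ≤ l.length → l.insertIdx i a = l.take i ++ a :: l.drop i
  | l, 0, _ => by simp
  | [], i + 1, h => by simp at h
  | x :: l, i + 1, h => by
    simp [insertIdx_eq_take_append_cons_drop a l (by simpa using h : i ≤ l.length)]

theorem RTwinstack.oneSided_iff (S : RTwinstack) :
    RTwinstack.oneSided S = true ↔ (∀ x ∈ S, x = true) ∨ ∀ x ∈ S, x = false := by
  simp [RTwinstack.oneSided]

theorem RTwinstack.oneSided_map_not (S : RTwinstack) :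
    RTwinstack.oneSided (S.map not) = RTwinstack.oneSided S := by
  rw [Bool.eq_iff_iff, RTwinstack.oneSided_iff, RTwinstack.oneSided_iff]
  simp [or_comm]

theorem RTwinstack.monotonic_orient (S : RTwinstack) :
    RTwinstack.monotonic (RTwinstack.orient S) = RTwinstack.monotonic S := by
  unfold RTwinstack.orient RTwinstack.monotonic
  split_ifs
  · rw [← List.map_dropLast, RTwinstack.oneSided_map_not]
  · rfl

theorem RTwinstack.head?_orient {S : RTwinstack} (hS : S ≠ []) :
    (RTwinstack.orient S).head? = some true := by
  match S with
  | true :: S => simp [RTwinstack.orient]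
  | false :: S => simp [RTwinstack.orient]

@[simp] theorem RTwinstack.setLastLeft_concat (Y : RTwinstack) (z : Bool) :
    RTwinstack.setLastLeft (Y ++ [z]) = Y ++ [true] := by
  simp [RTwinstack.setLastLeft]

theorem RTwinstack.le_leftRun_iff {S : RTwinstack} {i : ℕ} (hi : i ≤ S.length) :
    i ≤ RTwinstack.leftRun S ↔ ∀ x ∈ S.take i, x = true := by
  induction S generalizing i with
  | nil => simp at hi; simp [hi]
  | cons x S ih =>
    cases i with
    | zero => simp
    | succ i =>
      have := ih (i := i) (by simpa using hi)
      cases x <;> simp_all [RTwinstack.leftRun, List.findIdx_cons]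

theorem RTwinstack.Canonical.ne_nil {b : Bool} {S : RTwinstack} (hS : RTwinstack.Canonical b S) :
    S ≠ [] := by
  rintro rfl
  simpa using hS.head

theorem RTwinstack.canonical_singleton (b : Bool) : RTwinstack.Canonical b [true] :=
  ⟨rfl, fun _ _ => by simp⟩

/-- If the postfix test fails for a bottom r-twinstack, the remainder is not monotonic; if it
succeeds, the last entry becomes `true`, and the first one is `true` already, so monotonic forces
all ones. -/
theorem RTwinstack.canonical_popped {S : RTwinstack} (b : Bool) {i : ℕ} (hi : i < S.length) :
    RTwinstack.Canonical b (RTwinstack.popped S b i) := by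
  have hne : S.drop i ≠ [] := by simpa using hi
  have hhead := RTwinstack.head?_orient hne
  have hmono := RTwinstack.monotonic_orient (S.drop i)
  have hne' : RTwinstack.orient (S.drop i) ≠ [] := by
    intro h0
    simp [h0] at hhead
  unfold RTwinstack.popped
  generalize RTwinstack.orient (S.drop i) = X at *
  split_ifs with hc
  · obtain ⟨Y, z, rfl⟩ := (List.eq_nil_or_concat' X).resolve_left hne'
    rw [RTwinstack.setLastLeft_concat]
    have hY : Y = [] ∨ ∃ Y', Y = true :: Y' := by
      match Y with
      | [] => simp
      | true :: Y' => simp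
      | false :: Y' => simp at hhead
    rcases hY with rfl | ⟨Y, rfl⟩
    · exact RTwinstack.canonical_singleton b
    · refine ⟨rfl, fun _ h => ?_⟩
      rw [RTwinstack.monotonic, List.dropLast_concat, RTwinstack.oneSided_iff] at h
      rcases h with h | h
      · intro x hx
        rcases List.mem_append.1 hx with hx | hx
        · exact h x hx
        · simpa using hx
      · simpa using h true (by simp)
  · refine ⟨hhead, fun hb h => absurd ⟨hb, ?_, hne'⟩ hc⟩
    rw [hmono] at h
    refine Nat.le_findGreatest (by omega) ?_
    rwa [show S.length - (S.length - i) = i by omega]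

/-- If `i < S.length`, the inserted `false` is preceded by a `true` and is not the last entry, so
the result is not monotonic. If `i = S.length` at the bottom, the result is all ones. -/
theorem RTwinstack.Canonical.merged {b b' : Bool} {S : RTwinstack}
    (hS : RTwinstack.Canonical b' S) (j : ℕ) {i : ℕ} (h1 : 1 ≤ i) (hi : i ≤ RTwinstack.leftRun S) :
    RTwinstack.Canonical b (RTwinstack.merged S b (j + 1) i) := by
  have hlen : i ≤ S.length := hi.trans (RTwinstack.leftRun_le_length S)
  have htrue := (RTwinstack.le_leftRun_iff hlen).1 hi
  obtain ⟨T, rfl⟩ : ∃ T, S = true :: T := by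
    have := hS.head
    match S with
    | true :: T => simp
    | false :: T => simp at this
    | [] => simp at this
  obtain ⟨i, rfl⟩ : ∃ i', i = i' + 1 := ⟨i - 1, by omega⟩
  unfold RTwinstack.merged
  rw [insertIdx_eq_take_append_cons_drop _ _ hlen, Nat.add_sub_cancel]
  split_ifs with hc
  · rw [hc.2, List.drop_length, List.take_length, RTwinstack.setLastLeft_concat]
    rw [hc.2, List.take_length] at htrue
    refine ⟨by cases j <;> simp [List.replicate_succ], fun _ _ x hx => ?_⟩
    rcases List.mem_append.1 hx with hx | hx
    · exact List.eq_of_mem_replicate hx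
    · rcases List.mem_append.1 hx with hx | hx
      · exact htrue x hx
      · simpa using hx
  · refine ⟨by cases j <;> simp [List.replicate_succ], fun hb h => ?_⟩
    have hlt : i + 1 < (true :: T).length := by
      rcases hlen.lt_or_eq with hlt | heq
      · exact hlt
      · exact absurd ⟨hb, heq⟩ hc
    have hne : T.drop i ≠ [] := by simpa using hlt
    rw [RTwinstack.monotonic, RTwinstack.oneSided_iff, List.take_succ_cons, List.drop_succ_cons,
      List.dropLast_append_of_ne_nil (by simp), List.dropLast_append_of_ne_nil (by simp),
      List.dropLast_cons_of_ne_nil hne] at h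
    rcases h with h | h
    · simpa using h false (by simp)
    · simpa using h true (by simp)

/-- The recursion counts the runs that start with a single r-twinstack. -/
theorem h_eq_count {b : Bool} {S : RTwinstack} (hS : S = [] ∨ RTwinstack.Canonical b S) (k : ℕ)
    (m : ℕ) : h S (m + 1) k b = Pile.count b k (m + 1) (RTwinstack.pile S) := by
  induction m using Nat.strong_induction_on generalizing S k b with
  | _ m ih =>
  match m, ih with
  | 0, _ =>
    rw [h, baseValue, Pile.count]
    refine if_congr ?_ rfl rfl
    rw [Pile.Signals, RTwinstack.size_pile]
    have hone : Pile.OneSided (RTwinstack.pile S) ↔ RTwinstack.oneSided S = true := by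
      unfold RTwinstack.pile
      split_ifs with h0
      · simp [h0, Pile.OneSided, RTwinstack.oneSided]
      · simp [Pile.OneSided]
    rw [hone]
    constructor
    · rintro (h0 | ⟨h0, h1⟩)
      · exact Or.inl h0
      · by_cases hk : k = 0
        · exact Or.inl hk
        · exact Or.inr ⟨h1, by omega⟩
    · rintro (h0 | ⟨h0, h1⟩)
      · exact Or.inl h0
      · exact Or.inr ⟨by omega, h0⟩
  | m + 1, ih =>
    -- From the empty pile, the new element either stays or is output at once.
    have hnil : ∀ (b : Bool) (k : ℕ), h [true] (m + 1) k b + h [] (m + 1) k b =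
        Pile.count b k (m + 2) [] := by
      intro b k
      rw [ih m (by omega) (Or.inr (RTwinstack.canonical_singleton b)),
        ih m (by omega) (Or.inl rfl)]
      simp [Pile.count, Pile.steps, Pile.push, Pile.pop, RTwinstack.pile, List.range_succ]
    rw [h]
    split_ifs with h0
    · rw [hnil, h0, RTwinstack.pile, if_pos rfl]
    · replace hS := hS.resolve_left h0
      -- The bound `m + 4` is merely large enough to contain every range `i + 3` of the recursion.
      rw [RTwinstack.pile, if_neg h0, count_cons hS k (m + 4) (m + 1) [] (by simp)]
      congr 1
      · cases getKPrime S k with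
        | none => rfl
        | some k' => exact hnil false k'
      · rw [← Fin.sum_univ_eq_sum_range (fun i => ∑ j ∈ Finset.range (m + 4),
          Pile.count false j (i + 1) [] * transitionSum b S j
            (fun S' => Pile.count b k (m + 1 - i) (RTwinstack.pile S')))]
        refine Finset.sum_congr rfl fun i _ => ?_
        have hi := i.2
        have hsub : ∑ j ∈ Finset.range (i.val + 3), Pile.count false j (i.val + 1) [] *
            transitionSum b S j (fun S' => Pile.count b k (m + 1 - i) (RTwinstack.pile S')) =
            ∑ j ∈ Finset.range (m + 4), Pile.count false j (i.val + 1) [] *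
            transitionSum b S j (fun S' => Pile.count b k (m + 1 - i) (RTwinstack.pile S')) := by
          apply Finset.sum_subset
          · intro x; simp; omega
          · intro x _ hx
            rw [count_eq_zero false (by simp at hx ⊢; omega), zero_mul]
        rw [← hsub]
        refine Finset.sum_congr rfl fun j _ => ?_
        rw [ih i.val (by omega) (Or.inl rfl), transitionSum]
        congr 2
        apply List.map_congr_left
        intro S' hS'
        rw [show m + 2 - (i.val + 1) = (m - i.val) + 1 by omega,
          show m + 1 - i.val = (m - i.val) + 1 by omega]
        refine ih (m - i.val) (by omega) ?_ k
        rw [List.mem_filter] at hS'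
        cases j with
        | zero =>
          rw [transitionList_zero] at hS'
          obtain ⟨i, hi, rfl⟩ := List.mem_map.1 hS'.1
          rw [List.mem_range] at hi
          rcases (show i ≤ S.length by omega).lt_or_eq with hlt | heq
          · exact Or.inr (RTwinstack.canonical_popped b hlt)
          · left
            rw [← List.length_eq_zero_iff, RTwinstack.length_popped, heq, Nat.sub_self]
        | succ j =>
          rw [transitionList_succ] at hS'
          obtain ⟨i, hi, rfl⟩ := List.mem_map.1 hS'.1
          rw [List.mem_range'_1] at hi
          exact Or.inr (hS.merged j (by omega) (by omega))

end SwitchyardSorting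

namespace SwitchyardSorting

/-! ### Correctness of memoization -/

/-- Every stored value is the value of the recursion at its key. -/
def Dictionary.Correct (d : Dictionary) : Prop :=
  ∀ S m k b v, d (S, m, k, b) = some v → v = h S m k b

/-- Started with a correct dictionary, the computation returns `v` and a correct dictionary. -/
def Computes (c : StateM Dictionary ℕ) (v : ℕ) : Prop :=
  ∀ d : Dictionary, d.Correct → (c.run d).1 = v ∧ (c.run d).2.Correct

theorem Computes.pure (v : ℕ) : Computes (pure v) v := fun _ hd => ⟨rfl, hd⟩

theorem Computes.bind {c : StateM Dictionary ℕ} {v w : ℕ} {f : ℕ → StateM Dictionary ℕ}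
    (hc : Computes c v) (hf : Computes (f v) w) : Computes (c >>= f) w := by
  intro d hd
  obtain ⟨h1, h2⟩ := hc d hd
  have h3 := hf _ h2
  rw [← h1] at h3
  exact h3

theorem Computes.foldlM {α : Type} (f : ℕ → α → StateM Dictionary ℕ) (g : α → ℕ) (l : List α)
    (hf : ∀ a ∈ l, ∀ r, Computes (f r a) (r + g a)) (r : ℕ) :
    Computes (l.foldlM f r) (r + (l.map g).sum) := by
  induction l generalizing r with
  | nil => simpa using Computes.pure r
  | cons a l ih =>
    rw [List.foldlM_cons, List.map_cons, List.sum_cons, ← add_assoc]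
    exact (hf a (by simp) r).bind (ih (fun x hx => hf x (by simp [hx])) _)

/-- A hit is right because the dictionary is correct, and a miss leaves the dictionary unchanged, so
only the computation itself matters. -/
theorem Computes.lookup {c : StateM Dictionary ℕ} {S : RTwinstack} {m k : ℕ} {b : Bool}
    (hc : Computes c (h S m k b)) :
    Computes (do
      let dictionary ← get
      match dictionary (S, m, k, b) with
      | some v => return v
      | none => c) (h S m k b) := by
  intro d hd
  cases hv : d (S, m, k, b) with
  | some v =>
    obtain rfl : v = h S m k b := hd _ _ _ _ _ hv
    simp only [StateT.run_bind, StateT.run_get, pure_bind, hv]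
    exact ⟨rfl, hd⟩
  | none =>
    simp only [StateT.run_bind, StateT.run_get, pure_bind, hv]
    exact hc d hd

theorem Computes.store (S : RTwinstack) (m k : ℕ) (b : Bool) {v : ℕ} (hv : v = h S m k b) :
    Computes (do
      modify fun dictionary => Function.update dictionary (S, m, k, b) (some v)
      return v) (h S m k b) := by
  subst hv
  intro d hd
  refine ⟨rfl, ?_⟩
  intro S' m' k' b' v' hv'
  change Function.update d (S, m, k, b) (some (h S m k b)) (S', m', k', b') = some v' at hv'
  by_cases he : (S', m', k', b') = (S, m, k, b)
  · rw [he, Function.update_self] at hv'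
    simp only [Prod.mk.injEq] at he
    obtain ⟨rfl, rfl, rfl, rfl⟩ := he
    simpa using hv'.symm
  · rw [Function.update_of_ne he] at hv'
    exact hd _ _ _ _ _ hv'

theorem sum_map_filter_ne (l : List RTwinstack) (S : RTwinstack) (g : RTwinstack → ℕ) :
    ((l.filter (fun S' => S' ≠ S)).map g).sum = (l.map fun S' => if S' = S then 0 else g S').sum := by
  induction l with
  | nil => rfl
  | cons a l ih => by_cases ha : a = S <;> simp_all

theorem computes_relativisticHistories (m : ℕ) : ∀ (S : RTwinstack) (k : ℕ) (b : Bool),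
    Computes (relativisticHistories S m k b) (h S m k b) := by
  induction m using Nat.strong_induction_on with
  | _ m ih =>
  intro S k b
  rw [relativisticHistories.eq_def]
  apply Computes.lookup
  match m, ih with
  | 0, _ => exact (Computes.pure 0).bind (Computes.store S 0 k b (by rw [h]))
  | 1, _ => exact (Computes.pure _).bind (Computes.store S 1 k b (by rw [h]))
  | m + 2, ih =>
    by_cases hS : S = []
    · simp only [hS, if_true]
      exact (ih (m + 1) (by omega) _ _ _).bind ((ih (m + 1) (by omega) _ _ _).bind
        ((Computes.pure _).bind (Computes.store [] (m + 2) k b (by rw [h, if_pos rfl]))))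
    · simp only [hS, if_false]
      -- The accumulator is arbitrary because the loops start from the contribution of the runs that
      -- never change `S`.
      have key : ∀ r, Computes
          (List.foldlM (fun r (i : Fin (m + 1)) =>
            (List.range (i.val + 3)).foldlM (fun r j =>
              (transitionList S j b).foldlM (fun r S' =>
                if S' = S then pure r
                else do
                  let u ← relativisticHistories [] (i.val + 1) j false
                  let v ← relativisticHistories S' (m + 2 - (i.val + 1)) k b
                  pure (r + u * v)) r) r) r (List.finRange (m + 1)))
          (r + ∑ i : Fin (m + 1), ∑ j ∈ Finset.range (i.val + 3),
            h [] (i.val + 1) j false *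
              (((transitionList S j b).filter (fun S' => S' ≠ S)).map
                (fun S' => h S' (m + 2 - (i.val + 1)) k b)).sum) := by
        intro r
        have hsum : ∀ f : Fin (m + 1) → ℕ, ∑ i, f i = ((List.finRange (m + 1)).map f).sum :=
          fun f => by rw [← List.ofFn_eq_map, List.sum_ofFn]
        rw [hsum]
        refine Computes.foldlM _ _ _ (fun i _ r => ?_) r
        have hrange : ∀ f : ℕ → ℕ, ∑ j ∈ Finset.range (i.val + 3), f j =
            ((List.range (i.val + 3)).map f).sum := fun f => rfl
        rw [hrange]
        refine Computes.foldlM _ _ _ (fun j _ r => ?_) r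
        rw [sum_map_filter_ne, ← List.sum_map_mul_left]
        refine Computes.foldlM _ _ _ (fun S' _ r => ?_) r
        split_ifs with hS'
        · exact Computes.pure r
        · exact (ih _ (by omega) _ _ _).bind
            ((ih _ (by omega) _ _ _).bind (Computes.pure _))
      cases hk : getKPrime S k with
      | none =>
        exact (Computes.pure 0).bind ((key 0).bind (Computes.store S (m + 2) k b (by
          rw [h, if_neg hS, hk])))
      | some k' =>
        exact (ih (m + 1) (by omega) _ _ _).bind ((ih (m + 1) (by omega) _ _ _).bind
          ((Computes.pure _).bind ((key _).bind (Computes.store S (m + 2) k b (by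
            rw [h, if_neg hS, hk])))))

theorem relativisticSortableCount_eq (n : ℕ) (b : Bool) :
    relativisticSortableCount n b = h [] n 0 b := by
  have hd : Dictionary.Correct (fun _ => none) := fun _ _ _ _ _ hv => by simp at hv
  cases b
  · exact (computes_relativisticHistories n [] 0 false _ hd).1
  · exact (computes_relativisticHistories n [] 0 true _ hd).1

end SwitchyardSorting

namespace SwitchyardSorting
open Relation

/-! ### Sorting on a deque by outputting elements as early as possible -/

section Greedy

variable {α : Type*} [LinearOrder α]

/-- The elements of a deque with content `D` can be output in increasing order. -/
inductive Poppable : List α → Prop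
  | nil : Poppable []
  | left {x : α} {D : List α} : (∀ y ∈ D, x < y) → Poppable D → Poppable (x :: D)
  | right {x : α} {D : List α} : (∀ y ∈ D, x < y) → Poppable D → Poppable (D ++ [x])

/-- Some element of `l` has to be output before `y`. -/
def blocked (l : List α) (y : α) : Bool := l.any (fun z => decide (z < y))

theorem blocked_iff {l : List α} {y : α} : blocked l y = true ↔ ∃ z ∈ l, z < y := by
  simp [blocked]

/-- The elements of `D` that have to wait for elements of `l`. -/
def keep (l D : List α) : List α := D.filter (blocked l)

/-- The input `l` can be sorted on a deque with content `D` if every element is output as early as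
possible. -/
def GreedySortable : List α → List α → Prop
  | _, [] => True
  | D, x :: l => (Poppable (x :: D) ∧ GreedySortable (keep l (x :: D)) l) ∨
      (Poppable (D ++ [x]) ∧ GreedySortable (keep l (D ++ [x])) l)

theorem Poppable.sublist {D D' : List α} (hD : Poppable D) (h : D'.Sublist D) : Poppable D' := by
  induction hD generalizing D' with
  | nil => rw [List.sublist_nil.1 h]; exact .nil
  | @left x D hx _ ih =>
    rcases List.sublist_cons_iff.1 h with hE | ⟨E, rfl, hE⟩
    · exact ih hE
    · exact .left (fun y hy => hx y (hE.subset hy)) (ih hE)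
  | @right x D hx _ ih =>
    obtain ⟨E, F, rfl, hE, hF⟩ := List.sublist_append_iff.1 h
    rcases List.sublist_cons_iff.1 hF with hG | ⟨G, rfl, hG⟩
    · rw [List.sublist_nil.1 hG, List.append_nil]
      exact ih hE
    · rw [List.sublist_nil.1 hG]
      exact .right (fun y hy => hx y (hE.subset hy)) (ih hE)

theorem Poppable.reverse {D : List α} (hD : Poppable D) : Poppable D.reverse := by
  induction hD with
  | nil => exact .nil
  | left hx _ ih => rw [List.reverse_cons]; exact .right (by simpa using hx) ih
  | right hx _ ih => rw [List.reverse_append]; exact .left (by simpa using hx) ih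

/-- Otherwise `a`, `b` and the last element would form a poppable deque whose least element is in
the middle. -/
theorem Poppable.eq_nil_of_lt {a b : α} {D : List α} (hD : Poppable (a :: b :: D)) (hb : b < a)
    (h : ∀ y ∈ D, b < y) : D = [] := by
  by_contra hne
  obtain ⟨E, c, rfl⟩ := (List.eq_nil_or_concat' D).resolve_left hne
  have hs : [a, b, c].Sublist (a :: b :: (E ++ [c])) := by simp
  generalize hF : [a, b, c] = F at hs
  have hp := hD.sublist hs
  have hbc : b < c := h c (by simp)
  cases hp with
  | nil => simp at hF
  | @left x D hx _ =>
    obtain ⟨rfl, rfl⟩ := List.cons.inj hF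
    exact lt_asymm hb (hx b (by simp))
  | @right x D hx _ =>
    obtain ⟨rfl, rfl⟩ : D = [a, b] ∧ x = c := by
      have := List.append_inj' (hF.symm.trans (show [a, b, c] = [a, b] ++ [c] from rfl)) rfl
      simpa using this
    exact lt_asymm hbc (hx b (by simp))

theorem keep_append (l D E : List α) : keep l (D ++ E) = keep l D ++ keep l E :=
  List.filter_append ..

/-- Waiting for `l` implies waiting for `x :: l`, so output made before `x` is read does not affect
what is left afterwards. -/
theorem keep_keep_cons (x : α) (l D : List α) : keep l (keep (x :: l) D) = keep l D := by
  unfold keep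
  rw [List.filter_filter]
  apply List.filter_congr
  intro y _
  rw [Bool.and_eq_left_iff_imp]
  intro h
  obtain ⟨z, hz, hlt⟩ := blocked_iff.1 h
  exact blocked_iff.2 ⟨z, by simp [hz], hlt⟩

end Greedy

variable {n : ℕ}

theorem DequeStep.exists_output {s t : NetState n (List (Fin n))} (h : DequeStep s t) :
    ∃ w, t.output = s.output ++ w ∧
      (w ++ (t.storage ++ t.input)).Perm (s.storage ++ s.input) := by
  cases h with
  | pushLeft o d i x => exact ⟨[], by simp, List.perm_middle.symm⟩
  | pushRight o d i x => exact ⟨[], by simp, by simp⟩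
  | popLeft o d i x => exact ⟨[x], rfl, by simp⟩
  | popRight o d i x => exact ⟨[x], rfl, by simpa using List.perm_middle.symm⟩

theorem exists_output {s t : NetState n (List (Fin n))} (h : ReflTransGen DequeStep s t) :
    ∃ w, t.output = s.output ++ w ∧
      (w ++ (t.storage ++ t.input)).Perm (s.storage ++ s.input) := by
  induction h using ReflTransGen.head_induction_on with
  | refl => exact ⟨[], by simp, by simp⟩
  | head hst _ ih =>
    obtain ⟨w, h1, h2⟩ := hst.exists_output
    obtain ⟨w', h3, h4⟩ := ih
    refine ⟨w ++ w', by rw [h3, h1, List.append_assoc], ?_⟩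
    rw [List.append_assoc]
    exact (h4.append_left w).trans h2

/-- Everything not yet output is appended after `x` in a final output that is increasing. -/
theorem lt_of_sorts {o D i : List (Fin n)} {x : Fin n}
    (h : ReflTransGen DequeStep ⟨o ++ [x], D, i⟩ ⟨List.finRange n, [], []⟩) :
    ∀ y ∈ D ++ i, x < y := by
  obtain ⟨w, h1, h2⟩ := exists_output h
  have hp := List.pairwise_lt_finRange n
  simp only [List.append_nil] at h1 h2
  rw [h1, List.pairwise_append] at hp
  exact fun y hy => hp.2.2 x (by simp) y (h2.mem_iff.2 hy)

theorem blocked_eq_false_of_lt {l : List (Fin n)} {x : Fin n} (h : ∀ y ∈ l, x < y) : blocked l x = false := by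
  rw [← Bool.not_eq_true, blocked_iff]
  rintro ⟨z, hz, hlt⟩
  exact lt_asymm hlt (h z hz)

/-- Greedy output is optimal: going backwards along a successful run, the greedy storage is a
sublist of the actual one, and sublists of poppable contents are poppable. -/
theorem poppable_and_greedySortable {s : NetState n (List (Fin n))}
    (h : ReflTransGen DequeStep s ⟨List.finRange n, [], []⟩) :
    Poppable s.storage ∧ GreedySortable (keep s.input s.storage) s.input := by
  induction h using ReflTransGen.head_induction_on with
  | refl => exact ⟨.nil, trivial⟩
  | head hst ht ih =>
    obtain ⟨h1, h2⟩ := ih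
    cases hst with
    | pushLeft o d i x =>
      refine ⟨h1.sublist (List.sublist_cons_self _ _), Or.inl ⟨h1.sublist ?_, ?_⟩⟩
      · exact List.Sublist.cons_cons _ List.filter_sublist
      · change GreedySortable (keep i ([x] ++ keep (x :: i) d)) i
        rw [keep_append, keep_keep_cons, ← keep_append]
        exact h2
    | pushRight o d i x =>
      refine ⟨h1.sublist (List.sublist_append_left _ _), Or.inr ⟨h1.sublist ?_, ?_⟩⟩
      · exact List.Sublist.append List.filter_sublist (List.Sublist.refl _)
      · rw [keep_append, keep_keep_cons, ← keep_append]
        exact h2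
    | popLeft o d i x =>
      have hlt := lt_of_sorts ht
      refine ⟨.left (fun y hy => hlt y (by simp [hy])) h1, ?_⟩
      have hx : blocked i x = false := blocked_eq_false_of_lt fun y hy => hlt y (by simp [hy])
      simpa [keep, hx] using h2
    | popRight o d i x =>
      have hlt := lt_of_sorts ht
      refine ⟨.right (fun y hy => hlt y (by simp [hy])) h1, ?_⟩
      have hx : blocked i x = false := blocked_eq_false_of_lt fun y hy => hlt y (by simp [hy])
      simpa [keep, hx] using h2

/-- The output `o` is an initial part of the sorted list. -/
structure SortState (o D l : List (Fin n)) : Prop where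
  perm : (o ++ (D ++ l)).Perm (List.finRange n)
  sorted : o.Pairwise (· < ·)
  lt : ∀ a ∈ o, ∀ y ∈ D ++ l, a < y

theorem SortState.pop {o D l : List (Fin n)} {x : Fin n} (h : SortState o (x :: D) l)
    (hx : ∀ y ∈ D, x < y) (hl : blocked l x = false) : SortState (o ++ [x]) D l := by
  have hnd : (o ++ (x :: D ++ l)).Nodup := h.perm.nodup_iff.2 (List.nodup_finRange n)
  refine ⟨by simpa using h.perm, ?_, ?_⟩
  · rw [List.pairwise_append]
    refine ⟨h.sorted, by simp, fun a ha y hy => ?_⟩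
    rw [List.mem_singleton.1 hy]
    exact h.lt a ha x (by simp)
  · intro a ha y hy
    rcases List.mem_append.1 ha with ha | ha
    · exact h.lt a ha y (by simpa using Or.inr (List.mem_append.1 hy))
    · rw [List.mem_singleton.1 ha]
      rcases List.mem_append.1 hy with hy | hy
      · exact hx y hy
      · rw [← Bool.not_eq_true, blocked_iff] at hl
        refine lt_of_le_of_ne (not_lt.1 fun hlt => hl ⟨y, hy, hlt⟩) ?_
        rintro rfl
        have := (List.nodup_append.1 hnd).2.1
        rw [List.cons_append, List.nodup_cons] at this
        exact this.1 (by simp [hy])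

theorem keep_eq_self {l D : List (Fin n)} {x : Fin n} (hx : ∀ y ∈ D, x < y)
    (hl : blocked l x = true) : keep l D = D := by
  unfold keep
  rw [List.filter_eq_self]
  intro y hy
  obtain ⟨z, hz, hlt⟩ := blocked_iff.1 hl
  exact blocked_iff.2 ⟨z, hz, hlt.trans (hx y hy)⟩

/-- A poppable deque offers its least element at an end. If that element has to wait, so does
everything else; otherwise output it and repeat. -/
theorem exists_pops {D : List (Fin n)} (hD : Poppable D) {o l : List (Fin n)}
    (h : SortState o D l) : ∃ o', ReflTransGen DequeStep ⟨o, D, l⟩ ⟨o', keep l D, l⟩ ∧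
      SortState o' (keep l D) l := by
  induction hD generalizing o with
  | nil => exact ⟨o, .refl, h⟩
  | @left x D hx _ ih =>
    cases hb : blocked l x with
    | true =>
      have : keep l (x :: D) = x :: D := by
        simpa [keep, hb] using keep_eq_self hx hb
      rw [this]
      exact ⟨o, .refl, h⟩
    | false =>
      have : keep l (x :: D) = keep l D := by simp [keep, hb]
      rw [this]
      obtain ⟨o', h1, h2⟩ := ih (h.pop hx hb)
      exact ⟨o', .head (.popLeft o D l x) h1, h2⟩
  | @right x D hx _ ih =>
    cases hb : blocked l x with
    | true =>
      have : keep l (D ++ [x]) = D ++ [x] := by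
        rw [keep, List.filter_append, ← keep, keep_eq_self hx hb]
        simp [hb]
      rw [this]
      exact ⟨o, .refl, h⟩
    | false =>
      have : keep l (D ++ [x]) = keep l D := by simp [keep, hb]
      rw [this]
      have h' : SortState o (x :: D) l := by
        have hp : (D ++ [x] ++ l).Perm (x :: D ++ l) := by
          simp
        exact ⟨(hp.symm.append_left o).trans h.perm, h.sorted,
          fun a ha y hy => h.lt a ha y (hp.mem_iff.2 hy)⟩
      obtain ⟨o', h1, h2⟩ := ih (h'.pop hx hb)
      exact ⟨o', .head (.popRight o D l x) h1, h2⟩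

theorem sorts_of_greedySortable {o D l : List (Fin n)} (hs : SortState o D l)
    (hD : ∀ y ∈ D, blocked l y = true) (hg : GreedySortable D l) :
    ReflTransGen DequeStep ⟨o, D, l⟩ ⟨List.finRange n, [], []⟩ := by
  induction l generalizing o D with
  | nil =>
    obtain rfl : D = [] := List.eq_nil_iff_forall_not_mem.2 fun y hy => by
      simpa [blocked] using hD y hy
    obtain rfl : o = List.finRange n := by
      have := hs.perm
      simp only [List.append_nil] at this
      exact this.eq_of_pairwise (fun a b _ _ h1 h2 => absurd h2 (lt_asymm h1)) hs.sorted
        (List.pairwise_lt_finRange n)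
    exact .refl
  | cons x l ih =>
    rcases hg with ⟨h1, h2⟩ | ⟨h1, h2⟩
    · have hp : (x :: D ++ l).Perm (D ++ x :: l) := List.perm_middle.symm
      obtain ⟨o', h3, h4⟩ := exists_pops h1 (o := o) (l := l)
        ⟨(hp.append_left o).trans hs.perm, hs.sorted,
          fun a ha y hy => hs.lt a ha y (hp.mem_iff.1 hy)⟩
      exact .head (.pushLeft o D l x) (h3.trans (ih h4 (fun y hy => (List.mem_filter.1 hy).2) h2))
    · have hp : (D ++ [x] ++ l).Perm (D ++ x :: l) := by simp
      obtain ⟨o', h3, h4⟩ := exists_pops h1 (o := o) (l := l)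
        ⟨(hp.append_left o).trans hs.perm, hs.sorted,
          fun a ha y hy => hs.lt a ha y (hp.mem_iff.1 hy)⟩
      exact .head (.pushRight o D l x) (h3.trans (ih h4 (fun y hy => (List.mem_filter.1 hy).2) h2))

theorem ofFn_perm_finRange (π : Equiv.Perm (Fin n)) : (List.ofFn π).Perm (List.finRange n) := by
  rw [List.ofFn_eq_map]
  exact Equiv.Perm.map_finRange_perm π

theorem dequeSortable_iff (π : Equiv.Perm (Fin n)) :
    DequeSortable π ↔ GreedySortable [] (List.ofFn π) :=
  ⟨fun h => (poppable_and_greedySortable h).2, fun h => sorts_of_greedySortable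
    ⟨by simpa using ofFn_perm_finRange π, by simp, by simp⟩ (by simp) h⟩

/-! ### Two parallel stacks as a deque with an immovable bottom element -/

/-- Join two stacks at an additional element larger than all others. -/
def joinStacks (s : NetState n (List (Fin n) × List (Fin n))) :
    NetState (n + 1) (List (Fin (n + 1))) :=
  ⟨s.output.map Fin.castSucc,
    s.storage.1.map Fin.castSucc ++ Fin.last n :: (s.storage.2.map Fin.castSucc).reverse,
    s.input.map Fin.castSucc⟩

theorem ParallelStep.joinStacks {s t : NetState n (List (Fin n) × List (Fin n))}
    (h : ParallelStep s t) : DequeStep (joinStacks s) (joinStacks t) := by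
  cases h with
  | pushLeft o l r i x => exact .pushLeft _ _ _ _
  | pushRight o l r i x =>
    simpa [SwitchyardSorting.joinStacks] using DequeStep.pushRight (o.map Fin.castSucc)
      (l.map Fin.castSucc ++ Fin.last n :: (r.map Fin.castSucc).reverse) (i.map Fin.castSucc)
      x.castSucc
  | popLeft o l r i x =>
    simpa [SwitchyardSorting.joinStacks] using DequeStep.popLeft (o.map Fin.castSucc)
      (l.map Fin.castSucc ++ Fin.last n :: (r.map Fin.castSucc).reverse) (i.map Fin.castSucc)
      x.castSucc
  | popRight o l r i x =>
    simpa [SwitchyardSorting.joinStacks] using DequeStep.popRight (o.map Fin.castSucc)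
      (l.map Fin.castSucc ++ Fin.last n :: (r.map Fin.castSucc).reverse) (i.map Fin.castSucc)
      x.castSucc

/-- The added element is the largest, so nothing can remain in the storage or input when it is
output. -/
theorem eq_final_of_last_output {s : NetState n (List (Fin n) × List (Fin n))}
    {D : List (Fin (n + 1))} (hD : D.length = s.storage.1.length + s.storage.2.length)
    (h : ReflTransGen DequeStep ⟨s.output.map Fin.castSucc ++ [Fin.last n], D,
      s.input.map Fin.castSucc⟩ ⟨List.finRange (n + 1), [], []⟩) :
    s = ⟨List.finRange n, ([], []), []⟩ := by
  have hlt := lt_of_sorts h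
  have hnil : D ++ s.input.map Fin.castSucc = [] :=
    List.eq_nil_iff_forall_not_mem.2 fun y hy => absurd (hlt y hy) (not_lt.2 (Fin.le_last y))
  obtain ⟨rfl, hi⟩ := List.append_eq_nil_iff.1 hnil
  obtain ⟨w, h1, h2⟩ := exists_output h
  simp only [hi, List.append_nil, List.perm_nil] at h2
  simp only [h2, List.append_nil, List.finRange_succ_last] at h1
  have ho : List.finRange n = s.output :=
    List.map_injective_iff.2 (Fin.castSucc_injective n) (List.append_cancel_right h1)
  obtain ⟨o, ⟨l, r⟩, i⟩ := s
  simp only [List.map_eq_nil_iff] at hi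
  simp only [List.length_nil] at hD
  have hl : l = [] := List.length_eq_zero_iff.1 (by omega)
  have hr : r = [] := List.length_eq_zero_iff.1 (by omega)
  simp only at ho
  rw [← ho, hl, hr, hi]

/-- Until the added element is output it keeps the two ends apart, so each deque step is a step on
one of the stacks; once it is output, the stacks have already finished. -/
theorem sorts_of_joinStacks_sorts {u : NetState (n + 1) (List (Fin (n + 1)))}
    (h : ReflTransGen DequeStep u ⟨List.finRange (n + 1), [], []⟩)
    {s : NetState n (List (Fin n) × List (Fin n))} (hu : u = joinStacks s) :
    ReflTransGen ParallelStep s ⟨List.finRange n, ([], []), []⟩ := by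
  induction h using ReflTransGen.head_induction_on generalizing s with
  | refl => simp [joinStacks] at hu
  | head hst ht ih =>
    obtain ⟨o, ⟨l, r⟩, i⟩ := s
    cases hst with
    | pushLeft o' d i' x =>
      simp only [joinStacks, NetState.mk.injEq] at hu
      obtain ⟨rfl, rfl, hi⟩ := hu
      obtain ⟨y, i, rfl, rfl, rfl⟩ := List.map_eq_cons_iff.1 hi.symm
      exact .head (.pushLeft o l r i y) (ih rfl)
    | pushRight o' d i' x =>
      simp only [joinStacks, NetState.mk.injEq] at hu
      obtain ⟨rfl, rfl, hi⟩ := hu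
      obtain ⟨y, i, rfl, rfl, rfl⟩ := List.map_eq_cons_iff.1 hi.symm
      exact .head (.pushRight o l r i y) (ih (by simp [joinStacks]))
    | popLeft o' d i' x =>
      simp only [joinStacks, NetState.mk.injEq] at hu
      obtain ⟨rfl, hd, rfl⟩ := hu
      cases l with
      | nil =>
        simp only [List.map_nil, List.nil_append, List.cons.injEq] at hd
        obtain ⟨rfl, rfl⟩ := hd
        rw [eq_final_of_last_output (s := ⟨o, ([], r), i⟩) (by simp) ht]
      | cons y l =>
        simp only [List.map_cons, List.cons_append, List.cons.injEq] at hd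
        obtain ⟨rfl, rfl⟩ := hd
        exact .head (.popLeft o l r i y) (ih (by simp [joinStacks]))
    | popRight o' d i' x =>
      simp only [joinStacks, NetState.mk.injEq] at hu
      obtain ⟨rfl, hd, rfl⟩ := hu
      cases r with
      | nil =>
        simp only [List.map_nil, List.reverse_nil] at hd
        obtain ⟨rfl, hx⟩ := List.append_inj' hd rfl
        obtain rfl : x = Fin.last n := by simpa using hx
        rw [eq_final_of_last_output (s := ⟨o, (l, []), i⟩) (by simp) ht]
      | cons y r =>
        simp only [List.map_cons, List.reverse_cons, ← List.cons_append, ← List.append_assoc] at hd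
        obtain ⟨rfl, hx⟩ := List.append_inj' hd rfl
        obtain rfl : x = y.castSucc := by simpa using hx
        exact .head (.popRight o l r i y) (ih (by simp [joinStacks]))

theorem parallelSortable_iff_deque (π : Equiv.Perm (Fin n)) :
    ParallelSortable π ↔ ReflTransGen DequeStep
      ⟨[], [Fin.last n], (List.ofFn π).map Fin.castSucc⟩ ⟨List.finRange (n + 1), [], []⟩ := by
  constructor
  · intro h
    have h1 := ReflTransGen.lift joinStacks (fun _ _ => ParallelStep.joinStacks) _ _ h
    refine ReflTransGen.trans h1 (.single ?_)
    rw [List.finRange_succ_last]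
    exact .popLeft _ [] _ _
  · intro h
    exact sorts_of_joinStacks_sorts h rfl

theorem parallelSortable_iff (π : Equiv.Perm (Fin n)) (hn : 0 < n) :
    ParallelSortable π ↔ GreedySortable [Fin.last n] ((List.ofFn π).map Fin.castSucc) := by
  rw [parallelSortable_iff_deque]
  have hblocked : blocked ((List.ofFn π).map Fin.castSucc) (Fin.last n) = true :=
    blocked_iff.2 ⟨(π ⟨0, hn⟩).castSucc, by simp [List.mem_ofFn], Fin.castSucc_lt_last _⟩
  constructor
  · intro h
    have := (poppable_and_greedySortable h).2
    rwa [keep, List.filter_cons_of_pos hblocked, List.filter_nil] at this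
  · refine sorts_of_greedySortable ⟨?_, by simp, by simp⟩ (by simpa using hblocked)
    rw [List.finRange_succ_last, List.nil_append]
    exact List.perm_append_comm.trans
      (((ofFn_perm_finRange π).map _).append_right _)

end SwitchyardSorting

namespace SwitchyardSorting

/-! ### Deque contents described by bit strings -/

section Lay

variable {α : Type*}

/-- The deque content in which the elements of the increasing list `C` are, according to the bits
`σ`, to the left (`true`) or to the right (`false`) of all larger elements. -/
def lay : List α → List Bool → List α
  | c :: C, true :: σ => c :: lay C σ
  | c :: C, false :: σ => lay C σ ++ [c]
  | _, _ => []

/-- Attach `x` to the left (`true`) or the right (`false`) end of `D`. -/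
def attach (c : Bool) (x : α) (D : List α) : List α := if c = true then x :: D else D ++ [x]

theorem lay_perm {C : List α} {σ : List Bool} (h : C.length = σ.length) : (lay C σ).Perm C := by
  induction C generalizing σ with
  | nil => simp [lay]
  | cons c C ih =>
    match σ with
    | [] => simp at h
    | true :: σ => exact (ih (by simpa using h)).cons c
    | false :: σ =>
      exact (List.perm_append_singleton c _).trans ((ih (by simpa using h)).cons c)

/-- The `r` smaller elements lie on the opposite side, so `x` at its end is still outside all larger
elements. -/
theorem lay_insertIdx {C : List α} {σ : List Bool} (h : C.length = σ.length) (x : α) (c : Bool)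
    {r : ℕ} (hr : r ≤ σ.length) (hσ : ∀ a ∈ σ.take r, a = !c) :
    lay (C.insertIdx r x) (σ.insertIdx r c) = attach c x (lay C σ) := by
  induction r generalizing C σ with
  | zero => cases c <;> simp [lay, attach]
  | succ r ih =>
    match C, σ with
    | [], [] => simp at hr
    | _ :: _, [] => simp at h
    | [], _ :: _ => simp at h
    | y :: C, a :: σ =>
      obtain rfl : a = !c := hσ a (by simp)
      have := ih (C := C) (σ := σ) (by simpa using h) (by simpa using hr)
        (fun a ha => hσ a (by simp [ha]))
      rw [List.insertIdx_succ_cons, List.insertIdx_succ_cons]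
      cases c <;> simp only [Bool.not_true, Bool.not_false, lay, this] <;> simp [attach]

theorem lay_map_not {C : List α} {σ : List Bool} : lay C (σ.map not) = (lay C σ).reverse := by
  induction C generalizing σ with
  | nil => simp [lay]
  | cons c C ih =>
    match σ with
    | [] => simp [lay]
    | true :: σ => simp [lay, ih]
    | false :: σ => simp [lay, ih]

variable [LinearOrder α]

theorem greedySortable_cons {D : List α} {x : α} {l : List α} : GreedySortable D (x :: l) ↔
    ∃ c, Poppable (attach c x D) ∧ GreedySortable (keep l (attach c x D)) l := by
  simp [GreedySortable, attach, or_comm]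

theorem poppable_lay {C : List α} {σ : List Bool} (h : C.length = σ.length)
    (hC : C.Pairwise (· < ·)) : Poppable (lay C σ) := by
  induction C generalizing σ with
  | nil => exact .nil
  | cons c C ih =>
    rw [List.pairwise_cons] at hC
    match σ with
    | [] => simp at h
    | true :: σ =>
      have hl : C.length = σ.length := by simpa using h
      exact .left (fun y hy => hC.1 y ((lay_perm hl).mem_iff.1 hy)) (ih hl hC.2)
    | false :: σ =>
      have hl : C.length = σ.length := by simpa using h
      exact .right (fun y hy => hC.1 y ((lay_perm hl).mem_iff.1 hy)) (ih hl hC.2)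

theorem keep_lay {C : List α} {σ : List Bool} (h : C.length = σ.length)
    (hC : C.Pairwise (· < ·)) (l : List α) :
    keep l (lay C σ) = lay (C.drop (C.countP fun z => !blocked l z))
      (σ.drop (C.countP fun z => !blocked l z)) := by
  induction C generalizing σ with
  | nil => simp [lay, keep]
  | cons c C ih =>
    rw [List.pairwise_cons] at hC
    cases hb : blocked l c with
    | true =>
      have hall : ∀ z ∈ c :: C, blocked l z = true := by
        intro z hz
        rcases List.mem_cons.1 hz with rfl | hz
        · exact hb
        · obtain ⟨w, hw, hlt⟩ := blocked_iff.1 hb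
          exact blocked_iff.2 ⟨w, hw, hlt.trans (hC.1 z hz)⟩
      have h0 : (c :: C).countP (fun z => !blocked l z) = 0 := by
        rw [List.countP_eq_zero]
        intro z hz
        simp [hall z hz]
      rw [h0, List.drop_zero, List.drop_zero, keep, List.filter_eq_self]
      exact fun z hz => hall z ((lay_perm h).mem_iff.1 hz)
    | false =>
      rw [List.countP_cons_of_pos (by simp [hb])]
      match σ with
      | [] => simp at h
      | true :: σ => simpa [lay, keep, hb] using ih (σ := σ) (by simpa using h) hC.2
      | false :: σ => simpa [lay, keep, hb] using ih (σ := σ) (by simpa using h) hC.2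

/-- A smaller element on the left would sit right after `x` and be trapped by any larger element of
`C`. Hence the exception for the last bit: nothing larger is left to its right. -/
theorem eq_false_of_poppable_cons {C : List α} {σ : List Bool} (h : C.length = σ.length)
    (hC : C.Pairwise (· < ·)) {x : α} {r : ℕ} (hr : ∀ y ∈ C.take r, y < x)
    (hp : Poppable (x :: lay C σ)) : ∀ a ∈ σ.dropLast.take r, a = false := by
  induction C generalizing σ r with
  | nil =>
    obtain rfl : σ = [] := by simpa using h.symm
    simp
  | cons y C ih =>
    rw [List.pairwise_cons] at hC
    match r, σ with
    | 0, _ => simp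
    | r + 1, [] => simp
    | r + 1, [_] => simp
    | r + 1, true :: b :: σ =>
      have hl : C.length = (b :: σ).length := by simpa using h
      have hnil := Poppable.eq_nil_of_lt hp (hr y (by simp))
        (fun z hz => hC.1 z ((lay_perm hl).mem_iff.1 hz))
      have := (lay_perm hl).length_eq
      simp [hnil, hl] at this
    | r + 1, false :: b :: σ =>
      have hl : C.length = (b :: σ).length := by simpa using h
      have := ih (σ := b :: σ) hl hC.2 (r := r) (fun z hz => hr z (by simp [hz]))
        (hp.sublist (by simp [lay]))
      simpa using this

theorem eq_not_of_poppable_attach {C : List α} {σ : List Bool} (h : C.length = σ.length)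
    (hC : C.Pairwise (· < ·)) {x : α} {r : ℕ} (hr : ∀ y ∈ C.take r, y < x) {c : Bool}
    (hp : Poppable (attach c x (lay C σ))) : ∀ a ∈ σ.dropLast.take r, a = !c := by
  cases c with
  | true => simpa using eq_false_of_poppable_cons h hC hr hp
  | false =>
    have := eq_false_of_poppable_cons (σ := σ.map not) (by simpa using h) hC hr
      (by simpa [lay_map_not, attach] using hp.reverse)
    intro a ha
    rw [← List.map_dropLast, ← List.map_take] at this
    simpa using this (!a) (List.mem_map_of_mem ha)

end Lay

/-! ### Bit strings compatible with a pile -/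

/-- The bit strings are equal or, if `b` is true, differ at most in the last entry. -/
def AgreeUpToLast (b : Bool) (σ τ : List Bool) : Prop :=
  σ = τ ∨ (b = true ∧ ∃ ρ a a', σ = ρ ++ [a] ∧ τ = ρ ++ [a'])

namespace AgreeUpToLast

variable {b : Bool} {σ τ υ : List Bool}

theorem refl (σ : List Bool) : AgreeUpToLast b σ σ := Or.inl rfl

theorem symm (h : AgreeUpToLast b σ τ) : AgreeUpToLast b τ σ := by
  rcases h with rfl | ⟨hb, ρ, a, a', rfl, rfl⟩
  · exact refl _
  · exact Or.inr ⟨hb, ρ, a', a, rfl, rfl⟩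

theorem trans (h : AgreeUpToLast b σ τ) (h' : AgreeUpToLast b τ υ) : AgreeUpToLast b σ υ := by
  rcases h with rfl | ⟨hb, ρ, a, a', rfl, rfl⟩
  · exact h'
  · rcases h' with rfl | ⟨_, ρ', c, c', h1, rfl⟩
    · exact Or.inr ⟨hb, ρ, a, a', rfl, rfl⟩
    · obtain ⟨rfl, _⟩ := List.append_inj' h1 rfl
      exact Or.inr ⟨hb, ρ, a, c', rfl, rfl⟩

theorem length_eq (h : AgreeUpToLast b σ τ) : σ.length = τ.length := by
  rcases h with rfl | ⟨_, ρ, a, a', rfl, rfl⟩ <;> simp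

theorem append_left (α : List Bool) (h : AgreeUpToLast b σ τ) :
    AgreeUpToLast b (α ++ σ) (α ++ τ) := by
  rcases h with rfl | ⟨hb, ρ, a, a', rfl, rfl⟩
  · exact refl _
  · exact Or.inr ⟨hb, α ++ ρ, a, a', by simp, by simp⟩

theorem drop (i : ℕ) (h : AgreeUpToLast b σ τ) : AgreeUpToLast b (σ.drop i) (τ.drop i) := by
  rcases h with rfl | ⟨hb, ρ, a, a', rfl, rfl⟩
  · exact refl _
  · rcases le_or_gt i ρ.length with hi | hi
    · exact Or.inr ⟨hb, ρ.drop i, a, a', List.drop_append_of_le_length hi,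
        List.drop_append_of_le_length hi⟩
    · rw [List.drop_eq_nil_of_le (by simp; omega), List.drop_eq_nil_of_le (by simp; omega)]
      exact refl _

theorem map (f : Bool → Bool) (h : AgreeUpToLast b σ τ) :
    AgreeUpToLast b (σ.map f) (τ.map f) := by
  rcases h with rfl | ⟨hb, ρ, a, a', rfl, rfl⟩
  · exact refl _
  · exact Or.inr ⟨hb, ρ.map f, f a, f a', by simp, by simp⟩

theorem take_eq {i : ℕ} (h : AgreeUpToLast b σ τ) (hi : i < σ.length) :
    σ.take i = τ.take i := by
  rcases h with rfl | ⟨_, ρ, a, a', rfl, rfl⟩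
  · rfl
  · have : i ≤ ρ.length := by simpa [Nat.lt_succ_iff] using hi
    rw [List.take_append_of_le_length this, List.take_append_of_le_length this]

theorem setLastLeft (X : RTwinstack) : AgreeUpToLast true (RTwinstack.setLastLeft X) X := by
  rcases List.eq_nil_or_concat' X with rfl | ⟨Y, z, rfl⟩
  · exact refl _
  · exact Or.inr ⟨rfl, Y, true, z, by simp, rfl⟩

end AgreeUpToLast

/-- The bits `τ` describe a placement of the elements of the r-twinstack `S`. -/
def RTwinstack.Places (b : Bool) (S : RTwinstack) (τ : List Bool) : Prop :=
  ∃ c, AgreeUpToLast b (S.map (xor c)) τ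

/-- The bits `σ`, which start with the smallest element, describe a placement of the elements of
the pile `P`. -/
def Pile.Places : Bool → Pile → List Bool → Prop
  | _, [], σ => σ = []
  | b, S :: A, σ => ∃ α τ, σ = α ++ τ ∧ Pile.Places false A α ∧ RTwinstack.Places b S τ

/-- All r-twinstacks of the pile are canonical. -/
def Pile.Canonical : Bool → Pile → Prop
  | _, [] => True
  | b, S :: A => RTwinstack.Canonical b S ∧ Pile.Canonical false A

theorem map_xor_map_xor (c d : Bool) (S : List Bool) :
    (S.map (xor c)).map (xor d) = S.map (xor (xor c d)) := by
  rw [List.map_map]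
  congr 1
  funext x
  cases c <;> cases d <;> cases x <;> rfl

theorem RTwinstack.Places.length_eq {b : Bool} {S : RTwinstack} {τ : List Bool}
    (h : RTwinstack.Places b S τ) : τ.length = S.length := by
  obtain ⟨c, h⟩ := h
  simpa using h.length_eq.symm

theorem RTwinstack.Places.agree {b : Bool} {S : RTwinstack} {τ υ : List Bool}
    (h : RTwinstack.Places b S τ) (h' : AgreeUpToLast b τ υ) : RTwinstack.Places b S υ := by
  obtain ⟨c, h⟩ := h
  exact ⟨c, h.trans h'⟩

theorem RTwinstack.places_congr {b : Bool} {S S' : RTwinstack} {c : Bool} {τ : List Bool}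
    (h : AgreeUpToLast b (S.map (xor c)) S') :
    RTwinstack.Places b S τ ↔ RTwinstack.Places b S' τ := by
  constructor
  · rintro ⟨d, hd⟩
    refine ⟨xor c d, ((h.map (xor (xor c d))).symm.trans ?_)⟩
    rw [map_xor_map_xor]
    convert hd using 3
    simp
  · rintro ⟨d, hd⟩
    refine ⟨xor c d, ?_⟩
    rw [← map_xor_map_xor]
    exact (h.map (xor d)).trans hd

theorem RTwinstack.places_nil {b : Bool} {τ : List Bool} :
    RTwinstack.Places b [] τ ↔ τ = [] := by
  constructor
  · intro h
    simpa using h.length_eq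
  · rintro rfl
    exact ⟨true, .refl _⟩

theorem Pile.Places.length_eq {b : Bool} {P : Pile} {σ : List Bool} (h : Pile.Places b P σ) :
    σ.length = Pile.size P := by
  induction P generalizing b σ with
  | nil => simp [show σ = [] from h]
  | cons S A ih =>
    obtain ⟨α, τ, rfl, hα, hτ⟩ := h
    simp [ih hα, hτ.length_eq, add_comm]

/-- The free bit belongs to the bottom r-twinstack, because canonical r-twinstacks are nonempty. -/
theorem Pile.Places.agree {b : Bool} {P : Pile} {σ σ' : List Bool} (h : Pile.Places b P σ)
    (h' : AgreeUpToLast b σ σ') (hP : Pile.Canonical b P) : Pile.Places b P σ' := by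
  match P with
  | [] =>
    obtain rfl : σ = [] := h
    exact List.eq_nil_of_length_eq_zero (by simpa using h'.length_eq.symm)
  | S :: A =>
    obtain ⟨α, τ, rfl, hα, hτ⟩ := h
    rcases h' with rfl | ⟨rfl, ρ, a, a', h1, rfl⟩
    · exact ⟨α, τ, rfl, hα, hτ⟩
    · have hne : τ ≠ [] := by
        intro h0
        have := hτ.length_eq
        rw [h0, List.length_nil] at this
        exact hP.1.ne_nil (List.eq_nil_of_length_eq_zero this.symm)
      obtain ⟨υ, z, rfl⟩ := (List.eq_nil_or_concat' τ).resolve_left hne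
      rw [← List.append_assoc] at h1
      obtain ⟨rfl, _⟩ := List.append_inj' h1 rfl
      exact ⟨α, υ ++ [a'], by simp, hα, hτ.agree (Or.inr ⟨rfl, υ, z, a', rfl, rfl⟩)⟩

theorem Pile.exists_places (b : Bool) (P : Pile) : ∃ σ, Pile.Places b P σ := by
  induction P generalizing b with
  | nil => exact ⟨[], rfl⟩
  | cons S A ih =>
    obtain ⟨α, hα⟩ := ih false
    exact ⟨α ++ S.map (xor true), α, _, rfl, hα, true, .refl _⟩

theorem Pile.places_pile {b : Bool} {X : RTwinstack} {σ : List Bool} :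
    Pile.Places b (RTwinstack.pile X) σ ↔ RTwinstack.Places b X σ := by
  unfold RTwinstack.pile
  split_ifs with h
  · rw [h, RTwinstack.places_nil]
    rfl
  · constructor
    · rintro ⟨α, τ, rfl, hα, hτ⟩
      obtain rfl : α = [] := hα
      exact hτ
    · exact fun h => ⟨[], σ, rfl, rfl, h⟩

theorem RTwinstack.exists_agree_popped (b : Bool) (S : RTwinstack) (i : ℕ) :
    ∃ c, AgreeUpToLast b ((S.drop i).map (xor c)) (RTwinstack.popped S b i) := by
  have ho : ∃ c, (S.drop i).map (xor c) = RTwinstack.orient (S.drop i) := by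
    unfold RTwinstack.orient
    split_ifs
    · exact ⟨true, congrArg (List.map · _) (funext Bool.true_xor)⟩
    · exact ⟨false, (congrArg (List.map · _) (funext Bool.false_xor)).trans (List.map_id _)⟩
  obtain ⟨c, hc⟩ := ho
  refine ⟨c, ?_⟩
  rw [hc]
  unfold RTwinstack.popped
  split_ifs with h
  · rw [h.1]
    exact (AgreeUpToLast.setLastLeft _).symm
  · exact .refl _

theorem RTwinstack.places_popped {b : Bool} {S : RTwinstack} {i : ℕ} (hi : i ≤ S.length)
    {υ : List Bool} : RTwinstack.Places b (RTwinstack.popped S b i) υ ↔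
      ∃ τ, RTwinstack.Places b S τ ∧ τ.drop i = υ := by
  obtain ⟨c, hc⟩ := RTwinstack.exists_agree_popped b S i
  rw [← RTwinstack.places_congr hc]
  constructor
  · rintro ⟨d, hd⟩
    refine ⟨(S.take i).map (xor d) ++ υ, ⟨d, ?_⟩, ?_⟩
    · conv => enter [2]; rw [← List.take_append_drop i S, List.map_append]
      exact hd.append_left _
    · rw [List.drop_append_of_le_length (by simp [hi]), List.drop_eq_nil_of_le (by simp),
        List.nil_append]
  · rintro ⟨τ, ⟨d, hd⟩, rfl⟩
    refine ⟨d, ?_⟩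
    rw [List.map_drop]
    exact hd.drop i

/-- Blocks are flipped independently, so a placement of what remains extends over the removed
elements: removed blocks may be placed arbitrarily, and a cut block uses the same flip throughout.
-/
theorem Pile.places_pop {b : Bool} {P : Pile} {p : ℕ} (hp : p ≤ Pile.size P) {υ : List Bool} :
    Pile.Places b (Pile.pop b P p) υ ↔ ∃ σ, Pile.Places b P σ ∧ σ.drop p = υ := by
  induction P generalizing b υ with
  | nil =>
    constructor
    · intro h
      obtain rfl : υ = [] := h
      exact ⟨[], rfl, by simp⟩
    · rintro ⟨σ, h, rfl⟩
      obtain rfl : σ = [] := h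
      exact List.drop_nil
  | cons S A ih =>
    rw [Pile.pop]
    split_ifs with h
    · constructor
      · rintro ⟨α, τ, rfl, hα, hτ⟩
        obtain ⟨β, hβ, rfl⟩ := (ih h).1 hα
        exact ⟨β ++ τ, ⟨β, τ, rfl, hβ, hτ⟩,
          List.drop_append_of_le_length (by rw [hβ.length_eq]; exact h)⟩
      · rintro ⟨σ, ⟨α, τ, rfl, hα, hτ⟩, rfl⟩
        exact ⟨α.drop p, τ, List.drop_append_of_le_length (by rw [hα.length_eq]; exact h),
          (ih h).2 ⟨α, hα, rfl⟩, hτ⟩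
    · rw [Pile.size_cons] at hp
      rw [Pile.places_pile, RTwinstack.places_popped (by omega)]
      constructor
      · rintro ⟨τ, hτ, rfl⟩
        obtain ⟨α, hα⟩ := Pile.exists_places false A
        refine ⟨α ++ τ, ⟨α, τ, rfl, hα, hτ⟩, ?_⟩
        rw [List.drop_append, hα.length_eq,
          List.drop_eq_nil_of_le (as := α) (by rw [hα.length_eq]; omega), List.nil_append]
      · rintro ⟨σ, ⟨α, τ, rfl, hα, hτ⟩, rfl⟩
        refine ⟨τ, hτ, ?_⟩
        rw [List.drop_append, hα.length_eq,
          List.drop_eq_nil_of_le (as := α) (by rw [hα.length_eq]; omega), List.nil_append]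

theorem Pile.Canonical.pop {b : Bool} {P : Pile} (h : Pile.Canonical b P) (p : ℕ) :
    Pile.Canonical b (Pile.pop b P p) := by
  induction P generalizing b with
  | nil => trivial
  | cons S A ih =>
    rw [Pile.pop]
    split_ifs
    · exact ⟨h.1, ih h.2⟩
    · unfold RTwinstack.pile
      split_ifs with h0
      · trivial
      · refine ⟨RTwinstack.canonical_popped b ?_, trivial⟩
        have := RTwinstack.length_popped S b (p - Pile.size A)
        have := List.length_pos_iff.2 h0
        omega

theorem Pile.Canonical.push {b : Bool} {P P' : Pile} (h : Pile.Canonical b P) {r : ℕ}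
    (hP' : Pile.push b P r = some P') : Pile.Canonical b P' := by
  induction P generalizing b P' with
  | nil =>
    obtain rfl : [[true]] = P' := by simpa [Pile.push] using hP'
    exact ⟨RTwinstack.canonical_singleton b, trivial⟩
  | cons S A ih =>
    rw [Pile.push] at hP'
    split_ifs at hP' with h1 h2
    · obtain ⟨A', hA, rfl⟩ := Option.map_eq_some_iff.1 hP'
      exact ⟨h.1, ih h.2 hA⟩
    · obtain rfl := Option.some.inj hP'
      exact ⟨h.1.merged _ (by omega) h2.2, trivial⟩

theorem AgreeUpToLast.eq {σ τ : List Bool} (h : AgreeUpToLast false σ τ) : σ = τ := by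
  simpa [AgreeUpToLast] using h

theorem RTwinstack.oneSided_of_map_xor {S : RTwinstack} {c v : Bool}
    (h : ∀ x ∈ S.map (xor c), x = v) : RTwinstack.oneSided S = true := by
  have hx : ∀ x ∈ S, x = xor c v := by
    intro x hx
    rw [← h _ (List.mem_map_of_mem hx)]
    simp
  rw [RTwinstack.oneSided_iff]
  cases hv : xor c v
  · exact Or.inr fun x h => (hx x h).trans hv
  · exact Or.inl fun x h => (hx x h).trans hv

theorem Pile.Places.oneSided {P : Pile} {σ : List Bool} {v : Bool} (h : Pile.Places false P σ)
    (hσ : ∀ x ∈ σ, x = v) : Pile.OneSided P := by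
  induction P generalizing σ with
  | nil => exact fun S hS => absurd hS (by simp)
  | cons S A ih =>
    obtain ⟨α, τ, rfl, hα, c, hc⟩ := h
    obtain rfl := hc.eq
    intro T hT
    rcases List.mem_cons.1 hT with rfl | hT
    · exact RTwinstack.oneSided_of_map_xor fun x hx => hσ x (List.mem_append_right _ hx)
    · exact ih hα (fun x hx => hσ x (List.mem_append_left _ hx)) T hT

theorem Pile.OneSided.places_replicate {P : Pile} (h : Pile.OneSided P) (v : Bool) :
    Pile.Places false P (List.replicate (Pile.size P) v) := by
  induction P with
  | nil => rfl
  | cons S A ih =>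
    refine ⟨_, List.replicate S.length v, ?_, ih fun T hT => h T (List.mem_cons_of_mem _ hT), ?_⟩
    · rw [Pile.size_cons, add_comm, List.replicate_add]
    · rcases (RTwinstack.oneSided_iff S).1 (h S (by simp)) with hS | hS
      · refine ⟨!v, Or.inl (List.eq_replicate_iff.2 ⟨by simp, fun x hx => ?_⟩)⟩
        obtain ⟨y, hy, rfl⟩ := List.mem_map.1 hx
        simp [hS y hy]
      · refine ⟨v, Or.inl (List.eq_replicate_iff.2 ⟨by simp, fun x hx => ?_⟩)⟩
        obtain ⟨y, hy, rfl⟩ := List.mem_map.1 hx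
        simp [hS y hy]

theorem map_xor_insertIdx (c : Bool) (S : RTwinstack) (i : ℕ) :
    (S.insertIdx i false).map (xor c) = (S.map (xor c)).insertIdx i c := by
  rw [List.map_insertIdx, Bool.xor_false]

theorem insertIdx_append_left {β : Type*} {l l' : List β} {i : ℕ} (a : β) (hi : i ≤ l.length) :
    (l ++ l').insertIdx i a = l.insertIdx i a ++ l' := by
  rw [insertIdx_eq_take_append_cons_drop _ _ hi,
    insertIdx_eq_take_append_cons_drop _ _ (by simp; omega), List.take_append_of_le_length hi,
    List.drop_append_of_le_length hi]
  simp

theorem insertIdx_append_right {β : Type*} {l l' : List β} (i : ℕ) (a : β) (hi : i ≤ l'.length) :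
    (l ++ l').insertIdx (l.length + i) a = l ++ l'.insertIdx i a := by
  rw [insertIdx_eq_take_append_cons_drop _ _ hi,
    insertIdx_eq_take_append_cons_drop _ _ (by simp; omega), List.take_length_add_append,
    List.drop_length_add_append, List.append_assoc]

theorem AgreeUpToLast.insertIdx {b : Bool} {σ τ : List Bool} (h : AgreeUpToLast b σ τ) {i : ℕ}
    (hi : i < σ.length) (c : Bool) : AgreeUpToLast b (σ.insertIdx i c) (τ.insertIdx i c) := by
  rw [insertIdx_eq_take_append_cons_drop _ _ hi.le,
    insertIdx_eq_take_append_cons_drop _ _ (by rw [← h.length_eq]; exact hi.le), h.take_eq hi]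
  exact ((h.drop i).append_left [c]).append_left _

theorem map_xor_replicate (c : Bool) (j : ℕ) :
    (List.replicate j true).map (xor c) = List.replicate j (!c) := by
  simp

/-- The smallest element of `S` is on the left, so its bit reveals which flip was used. -/
theorem RTwinstack.Canonical.flip_eq {b c d : Bool} {S : RTwinstack}
    (hS : RTwinstack.Canonical b S) {i : ℕ} (hi : 1 ≤ i)
    (h : ∀ a ∈ (S.map (xor d)).take i, a = !c) : d = c ∧ ∀ a ∈ S.take i, a = true := by
  have hd : d = c := by
    have hh := hS.head
    match S, i with
    | true :: S, i + 1 =>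
      have := h (xor d true) (by simp)
      revert this
      cases c <;> cases d <;> simp
    | [], _ => simp at hh
    | false :: _, _ => simp at hh
  subst hd
  refine ⟨rfl, fun a ha => ?_⟩
  have := h (xor d a) (by rw [← List.map_take]; exact List.mem_map_of_mem ha)
  revert this
  cases a <;> cases d <;> simp

/-- A bottom or non-bottom r-twinstack takes a new element exactly as its placements do. -/
theorem RTwinstack.Places.merged {b c : Bool} {S : RTwinstack} (hS : RTwinstack.Canonical b S)
    {τ : List Bool} (hτ : RTwinstack.Places b S τ) {i : ℕ} (h1 : 1 ≤ i) (hi : i ≤ S.length)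
    (h : ∀ a ∈ τ.take i, a = !c) (j : ℕ) : i ≤ RTwinstack.leftRun S ∧
      RTwinstack.Places b (RTwinstack.merged S b (j + 1) i)
        (List.replicate j (!c) ++ τ.insertIdx i c) := by
  rw [RTwinstack.le_leftRun_iff hi]
  obtain ⟨d, hd⟩ := hτ
  have hlen : τ.length = S.length := by simpa using hd.length_eq.symm
  by_cases hc : b = true ∧ i = S.length
  -- Here the new element becomes the largest one. The previous largest may differ from the block's
  -- string in its free bit, so `S` is at first only known to be monotonic; canonicity makes it all
  -- ones.
  · obtain ⟨rfl, rfl⟩ := hc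
    rw [← hlen, List.take_length] at h
    have hall : ∀ a ∈ S, a = true := by
      refine hS.last rfl ?_
      refine RTwinstack.oneSided_of_map_xor (c := d) (v := !c) fun x hx => h x ?_
      rw [List.map_dropLast, List.dropLast_eq_take, hd.take_eq (by simp; omega)] at hx
      exact List.mem_of_mem_take hx
    refine ⟨fun a ha => hall a (List.mem_of_mem_take ha), c, ?_⟩
    rw [RTwinstack.merged, if_pos ⟨rfl, rfl⟩, Nat.add_sub_cancel, List.insertIdx_length_self,
      RTwinstack.setLastLeft_concat, ← hlen, List.insertIdx_length_self, List.map_append,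
      map_xor_replicate, List.map_append]
    refine AgreeUpToLast.append_left _ (Or.inr ⟨rfl, τ, xor c true, c, ?_, rfl⟩)
    rw [List.eq_replicate_of_mem h, List.eq_replicate_of_mem hall, map_xor_replicate, hlen]
    rfl
  · have key : (S.map (xor d)).take i = τ.take i ∧
        AgreeUpToLast b ((S.map (xor d)).insertIdx i c) (τ.insertIdx i c) := by
      cases b with
      | false => rw [hd.eq]; exact ⟨rfl, .refl _⟩
      | true =>
        have hlt : i < S.length := by
          rcases hi.lt_or_eq with h | h
          · exact h
          · exact absurd ⟨rfl, h⟩ hc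
        exact ⟨hd.take_eq (by simpa using hlt), hd.insertIdx (by simpa using hlt) c⟩
    rw [← key.1] at h
    obtain ⟨rfl, hall⟩ := hS.flip_eq h1 h
    refine ⟨hall, d, ?_⟩
    rw [RTwinstack.merged, if_neg hc, Nat.add_sub_cancel, List.map_append, map_xor_replicate,
      map_xor_insertIdx]
    exact key.2.append_left _

/-- If the smaller elements all lie on one side, every block above the affected one is one-sided and
the affected block begins with a left run; hence the pile accepts the element. -/
theorem Pile.Places.push {b c : Bool} {P : Pile} (hP : Pile.Canonical b P) {σ : List Bool}
    (h : Pile.Places b P σ) {r : ℕ} (hr : r ≤ Pile.size P) (hσ : ∀ a ∈ σ.take r, a = !c) :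
    ∃ P', Pile.push b P r = some P' ∧ Pile.Places b P' (σ.insertIdx r c) := by
  induction P generalizing b σ with
  | nil =>
    obtain rfl : σ = [] := h
    obtain rfl : r = 0 := by simpa using hr
    exact ⟨_, rfl, [], [c], rfl, rfl, !c, Or.inl (by simp)⟩
  | cons S A ih =>
    obtain ⟨α, τ, rfl, hα, hτ⟩ := h
    have hlen := hα.length_eq
    rw [Pile.push]
    split_ifs with h1 h2
    · rw [List.take_append_of_le_length (by omega)] at hσ
      obtain ⟨A', hA', hp⟩ := ih hP.2 hα h1 hσ
      refine ⟨S :: A', by rw [hA']; rfl, _, τ, insertIdx_append_left c (by omega), hp, hτ⟩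
    all_goals
      rw [Pile.size_cons] at hr
      obtain ⟨i, rfl⟩ : ∃ i, r = Pile.size A + i := ⟨r - Pile.size A, by omega⟩
      rw [← hlen, List.take_length_add_append] at hσ
      have hα' : ∀ a ∈ α, a = !c := fun a ha => hσ a (List.mem_append_left _ ha)
      have hm := hτ.merged (c := c) hP.1 (i := i) (by omega) (by omega)
        (fun a ha => hσ a (List.mem_append_right _ ha)) (Pile.size A)
    · rw [Nat.add_sub_cancel_left]
      refine ⟨_, rfl, [], _, ?_, rfl, hm.2⟩
      rw [← hlen, insertIdx_append_right i c (by rw [hτ.length_eq]; omega),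
        ← List.eq_replicate_of_mem hα']
      rfl
    · exact absurd ⟨hα.oneSided hα', by omega⟩ h2

/-- Conversely, the enlarged pile encodes nothing spurious. In a merge, the flip `c` of the merged
block is the side of the new element and forces all smaller elements to the other side. -/
theorem Pile.exists_places_of_push {b : Bool} {P P' : Pile} {r : ℕ} (hr : r ≤ Pile.size P)
    (hP' : Pile.push b P r = some P') {υ : List Bool} (hυ : Pile.Places b P' υ) :
    ∃ σ c, Pile.Places b P σ ∧ (∀ a ∈ σ.take r, a = !c) ∧ AgreeUpToLast b (σ.insertIdx r c) υ := by
  induction P generalizing b P' υ with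
  | nil =>
    obtain rfl : [[true]] = P' := by simpa [Pile.push] using hP'
    obtain rfl : r = 0 := by simpa using hr
    have hl := hυ.length_eq
    obtain ⟨c, rfl⟩ : ∃ c, υ = [c] := List.length_eq_one_iff.1 (by simpa using hl)
    exact ⟨[], c, rfl, by simp, .refl _⟩
  | cons S A ih =>
    rw [Pile.push] at hP'
    split_ifs at hP' with h1 h2
    · obtain ⟨A', hA, rfl⟩ := Option.map_eq_some_iff.1 hP'
      obtain ⟨α, τ, rfl, hα, hτ⟩ := hυ
      obtain ⟨β, c, hβ, hc, he⟩ := ih h1 hA hα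
      have hlen := hβ.length_eq
      refine ⟨β ++ τ, c, ⟨β, τ, rfl, hβ, hτ⟩, ?_, Or.inl ?_⟩
      · rwa [List.take_append_of_le_length (by omega)]
      · rw [insertIdx_append_left c (by omega), he.eq]
    · obtain rfl := Option.some.inj hP'
      obtain ⟨α, τ, rfl, hα, c, hc⟩ := hυ
      obtain rfl : α = [] := hα
      rw [Pile.size_cons] at hr
      obtain ⟨i, rfl⟩ : ∃ i, r = Pile.size A + i := ⟨r - Pile.size A, by omega⟩
      rw [Nat.add_sub_cancel_left] at h2 hc
      have hi : i ≤ S.length := by omega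
      have hl : (List.replicate (Pile.size A) (!c)).length = Pile.size A := by simp
      refine ⟨List.replicate (Pile.size A) (!c) ++ S.map (xor c), c,
        ⟨_, _, rfl, h2.1.places_replicate _, c, .refl _⟩, ?_, AgreeUpToLast.trans ?_ hc⟩
      · intro a ha
        nth_rw 1 [← hl] at ha
        rw [List.take_length_add_append, ← List.map_take] at ha
        rcases List.mem_append.1 ha with ha | ha
        · exact List.eq_of_mem_replicate ha
        · obtain ⟨x, hx, rfl⟩ := List.mem_map.1 ha
          rw [(RTwinstack.le_leftRun_iff hi).1 h2.2 x hx, Bool.xor_true]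
      · nth_rw 2 [← hl]
        rw [insertIdx_append_right i c (by simpa using hi), RTwinstack.merged, Nat.add_sub_cancel,
          List.map_append, map_xor_replicate, ← map_xor_insertIdx]
        refine AgreeUpToLast.append_left _ (AgreeUpToLast.map _ ?_)
        split_ifs with hb
        · rw [hb.1]
          exact (AgreeUpToLast.setLastLeft _).symm
        · exact .refl _

end SwitchyardSorting

namespace SwitchyardSorting

/-! ### Histories -/

section History

variable {α : Type*} [LinearOrder α]

/-- Insert `x` at its place in the increasing list `C`. -/
def insertSorted (C : List α) (x : α) : List α := C.insertIdx (C.countP (· < x)) x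

/-- The number of elements of `C` that do not have to wait for elements of `l`. -/
def released (l C : List α) : ℕ := C.countP fun z => !blocked l z

/-- The history of sorting `l` when the storage contains the elements of the increasing list `C`:
for every step but the last one, the number of smaller elements in the storage and the number of
elements that are output. -/
def history : List α → List α → List (ℕ × ℕ)
  | _, [] => []
  | _, [_] => []
  | C, x :: y :: l => (C.countP (· < x), released (y :: l) (insertSorted C x)) ::
      history ((insertSorted C x).drop (released (y :: l) (insertSorted C x))) (y :: l)

/-- The storage contains exactly the elements that have to wait for elements of `l`. -/
structure Waiting (C l : List α) : Prop where
  sorted : C.Pairwise (· < ·)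
  nodup : (C ++ l).Nodup
  blocked : ∀ y ∈ C, blocked l y = true

theorem take_drop_countP {β : Type*} (q : β → Bool) {C : List β}
    (hC : C.Pairwise (fun a b => q b = true → q a = true)) :
    (∀ a ∈ C.take (C.countP q), q a = true) ∧ ∀ a ∈ C.drop (C.countP q), q a = false := by
  induction C with
  | nil => simp
  | cons c C ih =>
    rw [List.pairwise_cons] at hC
    cases hc : q c with
    | true => simpa [hc] using ih hC.2
    | false =>
      have hall : ∀ a ∈ c :: C, q a = false := by
        intro a ha
        rcases List.mem_cons.1 ha with rfl | ha
        · exact hc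
        · rw [← Bool.not_eq_true]
          intro h
          simp [hC.1 a ha h] at hc
      have h0 : (c :: C).countP q = 0 := by
        rw [List.countP_eq_zero]
        intro a ha
        simp [hall a ha]
      rw [h0]
      exact ⟨by simp, hall⟩

theorem insertSorted_perm (C : List α) (x : α) : (insertSorted C x).Perm (x :: C) :=
  List.perm_insertIdx x C List.countP_le_length

theorem length_insertSorted (C : List α) (x : α) : (insertSorted C x).length = C.length + 1 :=
  (insertSorted_perm C x).length_eq

theorem take_rank_lt {C : List α} (hC : C.Pairwise (· < ·)) (x : α) :
    ∀ y ∈ C.take (C.countP (· < x)), y < x := by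
  have := (take_drop_countP (fun y => decide (y < x))
    (hC.imp fun {a b} hab hb => by simpa using hab.trans (by simpa using hb))).1
  simpa using this

theorem insertSorted_sorted {C : List α} {x : α} (hC : C.Pairwise (· < ·)) (hx : x ∉ C) :
    (insertSorted C x).Pairwise (· < ·) := by
  have h1 := take_rank_lt hC x
  have h2 := (take_drop_countP (fun y => decide (y < x))
    (hC.imp fun {a b} hab hb => by simpa using hab.trans (by simpa using hb))).2
  rw [insertSorted, insertIdx_eq_take_append_cons_drop _ _ List.countP_le_length]
  have h3 : ∀ y ∈ C.drop (C.countP (· < x)), x < y := by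
    intro y hy
    refine lt_of_le_of_ne (by simpa using h2 y hy) ?_
    rintro rfl
    exact hx (List.mem_of_mem_drop hy)
  rw [List.pairwise_append, List.pairwise_cons]
  refine ⟨hC.sublist (List.take_sublist _ _), ⟨h3, hC.sublist (List.drop_sublist _ _)⟩, ?_⟩
  intro a ha y hy
  rcases List.mem_cons.1 hy with rfl | hy
  · exact h1 a ha
  · exact (h1 a ha).trans (h3 y hy)

variable {C l : List α} {x : α}

theorem Waiting.insertSorted_sorted (h : Waiting C (x :: l)) :
    (insertSorted C x).Pairwise (· < ·) := by
  apply SwitchyardSorting.insertSorted_sorted h.sorted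
  intro hx
  exact (List.nodup_append.1 h.nodup).2.2 x hx x (by simp) rfl

theorem Waiting.pairwise_blocked (h : Waiting C (x :: l)) :
    (insertSorted C x).Pairwise fun a b =>
      (!SwitchyardSorting.blocked l b) = true → (!SwitchyardSorting.blocked l a) = true := by
  refine h.insertSorted_sorted.imp fun {a b} hab hb => ?_
  rw [Bool.not_eq_true', ← Bool.not_eq_true, blocked_iff] at hb ⊢
  rintro ⟨z, hz, hlt⟩
  exact hb ⟨z, hz, hlt.trans hab⟩

theorem Waiting.blocked_of_mem_drop (h : Waiting C (x :: l)) :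
    ∀ y ∈ (insertSorted C x).drop (released l (insertSorted C x)),
      SwitchyardSorting.blocked l y = true := by
  intro y hy
  simpa using (take_drop_countP _ h.pairwise_blocked).2 y hy

theorem insertSorted_append_perm (C l : List α) (x : α) :
    (insertSorted C x ++ l).Perm (C ++ x :: l) :=
  ((insertSorted_perm C x).append_right l).trans List.perm_middle.symm

theorem Waiting.insertSorted_append_nodup (h : Waiting C (x :: l)) :
    (insertSorted C x ++ l).Nodup :=
  (insertSorted_append_perm C l x).nodup_iff.2 h.nodup

theorem Waiting.lt_of_mem_take (h : Waiting C (x :: l)) :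
    ∀ y ∈ (insertSorted C x).take (released l (insertSorted C x)), ∀ z ∈ l, y < z := by
  intro y hy z hz
  have hb := (take_drop_countP _ h.pairwise_blocked).1 y hy
  rw [Bool.not_eq_true', ← Bool.not_eq_true, blocked_iff] at hb
  refine lt_of_le_of_ne (not_lt.1 fun hlt => hb ⟨z, hz, hlt⟩) ?_
  exact (List.nodup_append.1 h.insertSorted_append_nodup).2.2 y (List.mem_of_mem_take hy) z hz

theorem Waiting.next (h : Waiting C (x :: l)) :
    Waiting ((insertSorted C x).drop (released l (insertSorted C x))) l :=
  ⟨h.insertSorted_sorted.sublist (List.drop_sublist _ _),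
    h.insertSorted_append_nodup.sublist ((List.drop_sublist _ _).append_right l),
    h.blocked_of_mem_drop⟩

/-- Elements are output only after a new smallest element. -/
theorem Waiting.rank_eq_zero (h : Waiting C (x :: l)) (hp : 0 < released l (insertSorted C x)) :
    C.countP (· < x) = 0 := by
  obtain ⟨y, hy, hb⟩ := List.countP_pos_iff.1 hp
  rw [Bool.not_eq_true', ← Bool.not_eq_true, blocked_iff] at hb
  -- The released `y` is `x` or had been waiting for `x` alone, so `x` precedes all later input.
  have hxl : ∀ z ∈ l, ¬ z < x := by
    intro z hz hlt
    rcases List.mem_cons.1 ((insertSorted_perm C x).mem_iff.1 hy) with rfl | hy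
    · exact hb ⟨z, hz, hlt⟩
    · obtain ⟨w, hw, hwy⟩ := blocked_iff.1 (h.blocked y hy)
      rcases List.mem_cons.1 hw with rfl | hw
      · exact hb ⟨z, hz, hlt.trans hwy⟩
      · exact hb ⟨w, hw, hwy⟩
  rw [List.countP_eq_zero]
  intro y hy hyx
  obtain ⟨w, hw, hwy⟩ := blocked_iff.1 (h.blocked y hy)
  have hyx : y < x := by simpa using hyx
  rcases List.mem_cons.1 hw with rfl | hw
  · exact lt_asymm hwy hyx
  · exact hxl w hw (hwy.trans hyx)

end History

/-! ### Admissible histories -/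

/-- A history can be carried out on a pile. -/
def Pile.admits (b : Bool) : Pile → List (ℕ × ℕ) → Bool
  | _, [] => true
  | P, (r, p) :: H => match Pile.push b P r with
    | none => false
    | some P' => Pile.admits b (Pile.pop b P' p) H

theorem exists_agree_take {σ : List Bool} {r : ℕ} {v : Bool}
    (h : ∀ a ∈ σ.dropLast.take r, a = v) :
    ∃ τ, AgreeUpToLast true σ τ ∧ ∀ a ∈ τ.take r, a = v := by
  rcases List.eq_nil_or_concat' σ with rfl | ⟨ρ, z, rfl⟩
  · exact ⟨[], .refl _, by simp⟩
  · refine ⟨ρ ++ [v], Or.inr ⟨rfl, ρ, z, v, rfl, rfl⟩, fun a ha => ?_⟩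
    rw [List.dropLast_concat] at h
    rw [List.take_append] at ha
    rcases List.mem_append.1 ha with ha | ha
    · exact h a ha
    · simpa using List.mem_of_mem_take ha

/-- When the largest element is placed, nothing remains that it could be left or right of. -/
theorem lay_eq_of_agree {α : Type*} {C : List α} {σ τ : List Bool} (h : C.length = σ.length)
    (hστ : AgreeUpToLast true σ τ) : lay C σ = lay C τ := by
  rcases hστ with rfl | ⟨_, ρ, a, a', rfl, rfl⟩
  · rfl
  · induction ρ generalizing C with
    | nil =>
      obtain ⟨c, rfl⟩ := List.length_eq_one_iff.1 (show C.length = 1 by simpa using h)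
      cases a <;> cases a' <;> rfl
    | cons e ρ ih =>
      match C with
      | [] => simp at h
      | c :: C =>
        have := ih (C := C) (by simpa using h)
        cases e <;> simp [lay, this]

/-- Sorting on a deque amounts to carrying out the history on a pile. -/
theorem exists_greedySortable_iff_admits {α : Type*} [LinearOrder α] {C l : List α}
    (h : Waiting C l) (hl : l ≠ []) {P : Pile} (hP : Pile.Canonical true P)
    (hsize : Pile.size P = C.length) :
    (∃ σ, Pile.Places true P σ ∧ GreedySortable (lay C σ) l) ↔
      Pile.admits true P (history C l) = true := by
  induction l generalizing C P with
  | nil => exact absurd rfl hl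
  | cons x l ih =>
    cases l with
    | nil =>
      simp only [history, Pile.admits, iff_true]
      obtain ⟨σ, hσ⟩ := Pile.exists_places true P
      have hlen : C.length = σ.length := by rw [hσ.length_eq, hsize]
      refine ⟨σ, hσ, Or.inl ⟨.left (fun y hy => ?_) (poppable_lay hlen h.sorted), trivial⟩⟩
      simpa [blocked] using h.blocked y ((lay_perm hlen).mem_iff.1 hy)
    | cons y l =>
      rw [history, Pile.admits]
      have hrank : C.countP (· < x) ≤ C.length := List.countP_le_length
      have hpop : released (y :: l) (insertSorted C x) ≤ C.length + 1 := by
        rw [← length_insertSorted C x]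
        exact List.countP_le_length
      have hkeep : ∀ υ : List Bool, υ.length = C.length + 1 →
          keep (y :: l) (lay (insertSorted C x) υ) =
            lay ((insertSorted C x).drop (released (y :: l) (insertSorted C x)))
              (υ.drop (released (y :: l) (insertSorted C x))) := fun υ hυ =>
        keep_lay (by rw [hυ, length_insertSorted]) h.insertSorted_sorted _
      constructor
      · rintro ⟨σ, hσ, hg⟩
        have hlen : C.length = σ.length := by rw [hσ.length_eq, hsize]
        obtain ⟨c, hp, hg⟩ := greedySortable_cons.1 hg
        -- Poppability controls every smaller bit except possibly the last, which can be reset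
        -- without changing the deque.
        obtain ⟨τ, hστ, hτ⟩ := exists_agree_take
          (eq_not_of_poppable_attach hlen h.sorted (take_rank_lt h.sorted x) hp)
        have hlen' : C.length = τ.length := hlen.trans hστ.length_eq
        obtain ⟨P', hP', hplaces⟩ := (hσ.agree hστ hP).push hP (hrank.trans hsize.ge) hτ
        have hsize' := Pile.size_push (hrank.trans hsize.ge) hP'
        rw [hP']
        rw [lay_eq_of_agree hlen hστ, ← lay_insertIdx hlen' x c (hlen' ▸ hrank) hτ] at hg
        refine (ih h.next (by simp) ((hP.push hP').pop _) ?_).1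
          ⟨_, (Pile.places_pop (by omega)).2 ⟨_, hplaces, rfl⟩, ?_⟩
        · rw [Pile.size_pop, List.length_drop, length_insertSorted, hsize', hsize]
        · rw [← hkeep _ (by rw [hplaces.length_eq, hsize', hsize])]
          exact hg
      · cases hP' : Pile.push true P (C.countP (· < x)) with
        | none => simp
        | some P' =>
          intro ha
          have hsize' := Pile.size_push (hrank.trans hsize.ge) hP'
          obtain ⟨_, hpl, hg⟩ := (ih h.next (by simp) ((hP.push hP').pop _) (by
            rw [Pile.size_pop, List.length_drop, length_insertSorted, hsize', hsize])).2 ha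
          obtain ⟨υ, hυ, rfl⟩ := (Pile.places_pop (by omega)).1 hpl
          obtain ⟨σ, c, hσ, hc, hagree⟩ :=
            Pile.exists_places_of_push (hrank.trans hsize.ge) hP' hυ
          have hlen : C.length = σ.length := by rw [hσ.length_eq, hsize]
          have hlen' : υ.length = C.length + 1 := by rw [hυ.length_eq, hsize', hsize]
          have hlay : lay (insertSorted C x) υ = attach c x (lay C σ) := by
            rw [← lay_insertIdx hlen x c (hlen ▸ hrank) hc]
            refine (lay_eq_of_agree ?_ hagree).symm
            rw [length_insertSorted, hagree.length_eq, hlen']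
          rw [← hkeep υ hlen', hlay] at hg
          refine ⟨σ, hσ, greedySortable_cons.2 ⟨c, ?_, hg⟩⟩
          rw [← hlay]
          exact poppable_lay (by rw [hlen', length_insertSorted]) h.insertSorted_sorted

/-! ### Permutations and histories -/

/-- The output of a history on arbitrary elements. -/
def decode {β : Type*} : List (ℕ × ℕ) → List β → List β → List β
  | [], C, l => l ++ C
  | _ :: _, C, [] => C
  | (r, p) :: H, C, x :: l =>
    (C.insertIdx r x).take p ++ decode H ((C.insertIdx r x).drop p) l

theorem decode_map {β γ : Type*} (f : β → γ) (H : List (ℕ × ℕ)) (C l : List β) :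
    decode H (C.map f) (l.map f) = (decode H C l).map f := by
  induction H generalizing C l with
  | nil => simp [decode]
  | cons a H ih =>
    match l with
    | [] => rfl
    | x :: l =>
      rw [List.map_cons, decode, decode, ← List.map_insertIdx, ← List.map_take, ← List.map_drop,
        ih, List.map_append]

theorem decode_history {α : Type*} [LinearOrder α] {C l : List α} (h : Waiting C l) (hl : l ≠ []) :
    (decode (history C l) C l).Pairwise (· < ·) ∧ (decode (history C l) C l).Perm (C ++ l) := by
  induction l generalizing C with
  | nil => exact absurd rfl hl
  | cons x l ih =>
    cases l with
    | nil =>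
      refine ⟨List.pairwise_cons.2 ⟨fun y hy => ?_, h.sorted⟩, List.perm_append_comm⟩
      simpa [blocked] using h.blocked y hy
    | cons y l =>
      obtain ⟨h1, h2⟩ := ih h.next (by simp)
      rw [history, decode, ← insertSorted]
      constructor
      · rw [List.pairwise_append]
        refine ⟨h.insertSorted_sorted.sublist (List.take_sublist _ _), h1, fun a ha z hz => ?_⟩
        rcases List.mem_append.1 (h2.mem_iff.1 hz) with hz | hz
        · have := h.insertSorted_sorted
          rw [← List.take_append_drop (released (y :: l) (insertSorted C x)) (insertSorted C x),
            List.pairwise_append] at this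
          exact this.2.2 a ha z hz
        · exact h.lt_of_mem_take a ha z hz
      · refine (h2.append_left _).trans ?_
        rw [← List.append_assoc, List.take_append_drop]
        exact insertSorted_append_perm C (y :: l) x

theorem waiting_ofFn {n : ℕ} (π : Equiv.Perm (Fin n)) : Waiting [] (List.ofFn π) :=
  ⟨.nil, List.nodup_ofFn.2 π.injective, by simp⟩

/-- Decoding the history on positions instead of values gives a word that `π` maps to the sorted
list, so the history determines `π`. -/
theorem history_ofFn_injective {n : ℕ} (hn : 0 < n) :
    Function.Injective fun π : Equiv.Perm (Fin n) => history [] (List.ofFn π) := by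
  have key : ∀ π : Equiv.Perm (Fin n),
      (decode (history [] (List.ofFn π)) [] (List.finRange n)).map π = List.finRange n := by
    intro π
    obtain ⟨h1, h2⟩ := decode_history (waiting_ofFn π) (by simp; omega)
    rw [← decode_map, ← List.ofFn_eq_map, List.map_nil]
    exact (h2.trans (ofFn_perm_finRange π)).eq_of_pairwise
      (fun a b _ _ h1 h2 => absurd h2 (lt_asymm h1)) h1 (List.pairwise_lt_finRange n)
  intro π π' h
  have h1 := key π
  have h2 := key π'
  simp only at h
  rw [← h] at h2
  ext1 i
  have hi : i ∈ decode (history [] (List.ofFn π)) [] (List.finRange n) := by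
    have : π i ∈ (decode (history [] (List.ofFn π)) [] (List.finRange n)).map π := by
      rw [h1]
      exact List.mem_finRange _
    exact (List.mem_map_of_injective π.injective).1 this
  exact List.map_inj_left.1 (h1.trans h2.symm) i hi

/-- The histories of `m` steps that start with `s` stored elements and end with empty storage. -/
def histories : ℕ → ℕ → List (List (ℕ × ℕ))
  | 0, _ => []
  | 1, _ => [[]]
  | m + 2, s =>
    (List.range (s + 1)).flatMap (fun r => (histories (m + 1) (s + 1)).map ((r, 0) :: ·)) ++
      (List.range (s + 1)).flatMap (fun q => (histories (m + 1) (s - q)).map ((0, q + 1) :: ·))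

theorem history_mem_histories {α : Type*} [LinearOrder α] {C l : List α} (h : Waiting C l)
    (hl : l ≠ []) : history C l ∈ histories l.length C.length := by
  induction l generalizing C with
  | nil => exact absurd rfl hl
  | cons x l ih =>
    cases l with
    | nil => simp [history, histories]
    | cons y l =>
      have hmem := ih h.next (by simp)
      rw [List.length_drop, length_insertSorted] at hmem
      have hrank : C.countP (· < x) ≤ C.length := List.countP_le_length
      have hpop : released (y :: l) (insertSorted C x) ≤ C.length + 1 := by
        rw [← length_insertSorted C x]
        exact List.countP_le_length
      have hzero := h.rank_eq_zero
      rw [history]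
      simp only [List.length_cons, histories, List.mem_append, List.mem_flatMap, List.mem_range,
        List.mem_map]
      revert hmem hpop hzero
      generalize released (y :: l) (insertSorted C x) = p
      intro hmem hpop hzero
      cases p with
      | zero => exact Or.inl ⟨_, by omega, _, hmem, rfl⟩
      | succ q =>
        rw [Nat.add_sub_add_right] at hmem
        exact Or.inr ⟨q, by omega, _, hmem, by rw [hzero (by omega)]⟩

/-- Only `s = 0` is needed, where the count is `(m + 1)!`; the general form makes the induction
work. The output steps are summed by the hockey-stick identity `h1`. -/
theorem length_histories (m s : ℕ) :
    (histories (m + 1) s).length = (m + s).choose s * (m + 1).factorial := by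
  induction m generalizing s with
  | zero => simp [histories]
  | succ m ih =>
    have h1 : ∑ q ∈ Finset.range (s + 1), (m + (s - q)).choose (s - q) =
        (m + s + 1).choose s := by
      rw [← Finset.sum_range_reflect]
      have h2 := Nat.sum_range_add_choose s m
      rw [show s + m + 1 = s + (m + 1) by omega, ← Nat.choose_symm_add] at h2
      rw [show m + s + 1 = s + (m + 1) by omega, ← h2]
      refine Finset.sum_congr rfl fun q hq => ?_
      rw [Finset.mem_range] at hq
      rw [show s - (s + 1 - 1 - q) = q by omega, add_comm m q, Nat.choose_symm_add]
    have h3 : (m + s + 1).choose (s + 1) * (s + 1) = (m + s + 1).choose s * (m + 1) := by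
      rw [Nat.choose_succ_right_eq]
      congr 1
      omega
    have h4 : (histories (m + 2) s).length =
        (s + 1) * ((m + s + 1).choose (s + 1) * (m + 1).factorial) +
          ∑ q ∈ Finset.range (s + 1), (m + (s - q)).choose (s - q) * (m + 1).factorial := by
      simp only [histories, List.length_append, List.length_flatMap, List.length_map, ih]
      congr 1
      simp [add_assoc]
    rw [h4, ← Finset.sum_mul, h1, ← mul_assoc, mul_comm (s + 1), h3, Nat.factorial_succ (m + 1),
      show m + 1 + s = m + s + 1 by omega]
    ring

/-- Histories of permutations lie in a list of length `n!` and are distinct, so they exhaust the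
list and it has no repetitions. -/
theorem ncard_eq_countP {n : ℕ} (hn : 0 < n) (p : List (ℕ × ℕ) → Bool) :
    {π : Equiv.Perm (Fin n) | p (history [] (List.ofFn π)) = true}.ncard =
      (histories n 0).countP p := by
  classical
  obtain ⟨m, rfl⟩ : ∃ m, n = m + 1 := ⟨n - 1, by omega⟩
  set f := fun π : Equiv.Perm (Fin (m + 1)) => history [] (List.ofFn π) with hf
  have hinj : Function.Injective f := history_ofFn_injective hn
  have hlen : (histories (m + 1) 0).length = (m + 1).factorial := by
    simp [length_histories]
  have hcard : (Finset.univ.image f).card = (m + 1).factorial := by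
    rw [Finset.card_image_of_injective _ hinj, Finset.card_univ, Fintype.card_perm,
      Fintype.card_fin]
  have hsub : Finset.univ.image f ⊆ (histories (m + 1) 0).toFinset := by
    intro H hH
    obtain ⟨π, _, rfl⟩ := Finset.mem_image.1 hH
    rw [List.mem_toFinset]
    have := history_mem_histories (waiting_ofFn π) (by simp)
    rwa [List.length_ofFn] at this
  have hle := List.toFinset_card_le (histories (m + 1) 0)
  have heq : Finset.univ.image f = (histories (m + 1) 0).toFinset :=
    Finset.eq_of_subset_of_card_le hsub (by omega)
  have hnodup : (histories (m + 1) 0).Nodup := by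
    rw [← Multiset.coe_nodup, ← Multiset.toFinset_card_eq_card_iff_nodup]
    change (histories (m + 1) 0).toFinset.card = (histories (m + 1) 0).length
    rw [← heq, hcard, hlen]
  rw [List.countP_eq_length_filter, ← List.toFinset_card_of_nodup (hnodup.filter _),
    List.toFinset_filter, ← heq, Finset.filter_image, Finset.card_image_of_injective _ hinj,
    ← Set.ncard_coe_finset]
  congr 1
  ext π
  simp [hf]

/-! ### Counting the histories that a pile admits. -/

theorem Pile.pop_zero (b : Bool) (P : Pile) : Pile.pop b P 0 = P := by
  induction P generalizing b with
  | nil => rfl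
  | cons S A ih => rw [Pile.pop, if_pos (Nat.zero_le _), ih]

/-- A new smallest element can always be stored, as a block of its own on top, and is the first to
leave. Hence outputting `q + 1` elements after it amounts to outputting `q` old ones. -/
theorem Pile.exists_push_zero (b : Bool) (P : Pile) : ∃ P', Pile.push b P 0 = some P' ∧
    Pile.size P' = Pile.size P + 1 ∧ ∀ q, Pile.pop b P' (q + 1) = Pile.pop b P q := by
  induction P generalizing b with
  | nil =>
    refine ⟨_, rfl, by simp, fun q => ?_⟩
    rw [Pile.pop.eq_def]
    simp only
    rw [if_neg (by simp), RTwinstack.pile, if_pos]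
    · rfl
    · rw [← List.length_eq_zero_iff, RTwinstack.length_popped]
      simp
  | cons S A ih =>
    obtain ⟨A', h1, h2, h3⟩ := ih false
    refine ⟨S :: A', by rw [Pile.push, if_pos (Nat.zero_le _), h1]; rfl, by simp [h2]; omega,
      fun q => ?_⟩
    rw [Pile.pop, Pile.pop, h2, h3, Nat.add_sub_add_right]
    exact if_congr (by omega) rfl rfl

theorem sum_map_filterMap {β γ : Type*} (f : β → Option γ) (g : γ → ℕ) (l : List β) :
    ((l.filterMap f).map g).sum = (l.map fun a => (f a).elim 0 g).sum := by
  induction l with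
  | nil => rfl
  | cons a l ih => cases h : f a <;> simp [h, ih]

theorem countP_admits (b : Bool) (m : ℕ) (P : Pile) :
    (histories (m + 1) (Pile.size P)).countP (Pile.admits b P) = Pile.count b 0 (m + 1) P := by
  induction m generalizing P with
  | zero => simp [histories, Pile.admits, Pile.count, Pile.Signals]
  | succ m ih =>
    rw [histories, Pile.count, Pile.steps, List.map_append, List.sum_append, sum_map_filterMap,
      List.countP_append, List.countP_flatMap, List.countP_flatMap, List.map_map]
    congr 2
    · apply List.map_congr_left
      intro r hr
      simp only [Function.comp_apply, List.countP_map]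
      cases hP' : Pile.push b P r with
      | none => simp [Function.comp_def, Pile.admits, hP']
      | some P' =>
        rw [Option.elim_some, ← ih, Pile.size_push (by simpa [Nat.lt_succ_iff] using hr) hP']
        simp only [Function.comp_def, Pile.admits, hP', Pile.pop_zero]
    · apply List.map_congr_left
      intro q _
      obtain ⟨P', h1, _, h3⟩ := Pile.exists_push_zero b P
      simp only [Function.comp_apply, List.countP_map]
      rw [← ih, Pile.size_pop]
      simp only [Function.comp_def, Pile.admits, h1, h3]

/-- Above an r-twinstack, a pile behaves like a non-bottom pile. -/
theorem admits_singleton_cons {m : ℕ} {A : Pile} {H : List (ℕ × ℕ)}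
    (hH : H ∈ histories (m + 1) (Pile.size A)) (S : RTwinstack) :
    Pile.admits true (S :: A) H = Pile.admits false A H := by
  induction m generalizing A H with
  | zero =>
    obtain rfl : H = [] := by simpa [histories] using hH
    rfl
  | succ m ih =>
    simp only [histories, List.mem_append, List.mem_flatMap, List.mem_range, List.mem_map] at hH
    rcases hH with ⟨r, hr, H, hH, rfl⟩ | ⟨q, hq, H, hH, rfl⟩
    · rw [Pile.admits, Pile.admits, Pile.push, if_pos (by omega)]
      cases hA' : Pile.push false A r with
      | none => rfl
      | some A' =>
        simp only [Option.map_some, Pile.pop_zero]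
        rw [← Pile.size_push (by omega) hA'] at hH
        exact ih hH
    · obtain ⟨A', h1, h2, h3⟩ := Pile.exists_push_zero false A
      rw [Pile.admits, Pile.admits, Pile.push, if_pos (Nat.zero_le _), h1]
      simp only [Option.map_some]
      rw [Pile.pop, if_pos (by omega), h3]
      rw [← Pile.size_pop false A q] at hH
      exact ih hH

/-! ### Histories in the presence of an additional largest element. -/

theorem blocked_map_castSucc {n : ℕ} (l : List (Fin n)) (z : Fin n) :
    blocked (l.map Fin.castSucc) z.castSucc = blocked l z := by
  simp [blocked, List.any_map, Function.comp_def]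

/-- The added element is never smaller than a new one and, while input remains, never released. The
last step, which would release it, is not recorded. -/
theorem history_map_castSucc {n : ℕ} (C l : List (Fin n)) :
    history (C.map Fin.castSucc ++ [Fin.last n]) (l.map Fin.castSucc) = history C l := by
  induction l generalizing C with
  | nil => rfl
  | cons x l ih =>
    cases l with
    | nil => rfl
    | cons y l =>
      have hrank : (C.map Fin.castSucc ++ [Fin.last n]).countP (· < x.castSucc) =
          C.countP (· < x) := by
        rw [List.countP_append, List.countP_map]
        simp [Function.comp_def, Fin.le_last]
      have hins : insertSorted (C.map Fin.castSucc ++ [Fin.last n]) x.castSucc =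
          (insertSorted C x).map Fin.castSucc ++ [Fin.last n] := by
        rw [insertSorted, hrank, insertSorted,
          insertIdx_append_left _ (by simpa using List.countP_le_length), List.map_insertIdx]
      have hrel : ∀ E : List (Fin n), released ((y :: l).map Fin.castSucc)
          (E.map Fin.castSucc ++ [Fin.last n]) = released (y :: l) E := by
        intro E
        have hlast : blocked ((y :: l).map Fin.castSucc) (Fin.last n) = true :=
          blocked_iff.2 ⟨y.castSucc, by simp, Fin.castSucc_lt_last y⟩
        rw [released, List.countP_append, List.countP_map]
        simp only [Function.comp_def, blocked_map_castSucc]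
        rw [List.countP_cons_of_neg (by rw [hlast]; simp), List.countP_nil]
        rfl
      have := ih ((insertSorted C x).drop (released (y :: l) (insertSorted C x)))
      rw [List.map_drop, ← List.drop_append_of_le_length
        (by rw [List.length_map]; exact List.countP_le_length)] at this
      rw [history, ← this]
      change history _ (x.castSucc :: y.castSucc :: l.map Fin.castSucc) = _
      rw [history, hrank, hins]
      have hrel' := hrel (insertSorted C x)
      rw [List.map_cons] at hrel'
      rw [hrel', List.map_cons]

/-! ### Sortability in terms of piles, and the two enumerations. -/

theorem dequeSortable_iff_admits {n : ℕ} (hn : 0 < n) (π : Equiv.Perm (Fin n)) :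
    DequeSortable π ↔ Pile.admits true [] (history [] (List.ofFn π)) = true := by
  rw [dequeSortable_iff, ← exists_greedySortable_iff_admits (waiting_ofFn π) (by simp; omega)
    (P := []) trivial rfl]
  exact ⟨fun h => ⟨[], rfl, h⟩, fun ⟨σ, hσ, h⟩ => by simpa [lay] using h⟩

theorem parallelSortable_iff_admits {n : ℕ} (hn : 0 < n) (π : Equiv.Perm (Fin n)) :
    ParallelSortable π ↔ Pile.admits false [] (history [] (List.ofFn π)) = true := by
  have hmem : history [] (List.ofFn π) ∈ histories (n - 1 + 1) (Pile.size []) := by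
    have := history_mem_histories (waiting_ofFn π) (by simp; omega)
    rw [Nat.sub_add_cancel hn]
    rwa [List.length_ofFn] at this
  have hw : Waiting [Fin.last n] ((List.ofFn π).map Fin.castSucc) := by
    refine ⟨by simp, ?_, ?_⟩
    · rw [List.singleton_append, List.nodup_cons]
      refine ⟨fun h => ?_, (List.nodup_ofFn.2 π.injective).map (Fin.castSucc_injective n)⟩
      obtain ⟨y, _, hy⟩ := List.mem_map.1 h
      exact (Fin.castSucc_lt_last y).ne hy
    · intro y hy
      rw [List.mem_singleton.1 hy]
      exact blocked_iff.2 ⟨(π ⟨0, hn⟩).castSucc,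
        List.mem_map_of_mem (List.mem_ofFn.2 ⟨_, rfl⟩), Fin.castSucc_lt_last _⟩
  have hist := history_map_castSucc [] (List.ofFn π)
  rw [List.map_nil, List.nil_append] at hist
  rw [parallelSortable_iff π hn, ← admits_singleton_cons hmem [true], ← hist,
    ← exists_greedySortable_iff_admits hw (by simp; omega)
      (P := [[true]]) ⟨RTwinstack.canonical_singleton _, trivial⟩ rfl]
  -- The added element is the bottom block `[true]`; both of its placements give the same deque.
  have hlay : ∀ a, lay [Fin.last n] [a] = [Fin.last n] := by
    intro a
    cases a <;> rfl
  constructor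
  · intro h
    obtain ⟨σ, hσ⟩ := Pile.exists_places true [[true]]
    obtain ⟨a, rfl⟩ := List.length_eq_one_iff.1 (show σ.length = 1 from hσ.length_eq)
    exact ⟨_, hσ, by rwa [hlay]⟩
  · rintro ⟨σ, hσ, h⟩
    obtain ⟨a, rfl⟩ := List.length_eq_one_iff.1 (show σ.length = 1 from hσ.length_eq)
    rwa [hlay] at h

theorem h_eq_countP_admits (m : ℕ) (b : Bool) :
    h [] (m + 1) 0 b = (histories (m + 1) 0).countP (Pile.admits b []) := by
  rw [h_eq_count (Or.inl rfl), RTwinstack.pile, if_pos rfl, ← countP_admits b m []]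
  rfl

theorem h_eq_ncard_dequeClass {n : ℕ} (hn : 0 < n) : h [] n 0 true = (dequeClass n).ncard := by
  obtain ⟨m, rfl⟩ : ∃ m, n = m + 1 := ⟨n - 1, by omega⟩
  rw [h_eq_countP_admits, ← ncard_eq_countP hn]
  congr 1
  ext π
  exact (dequeSortable_iff_admits hn π).symm

theorem h_eq_ncard_parallelClass {n : ℕ} (hn : 0 < n) :
    h [] n 0 false = (parallelClass n).ncard := by
  obtain ⟨m, rfl⟩ : ∃ m, n = m + 1 := ⟨n - 1, by omega⟩
  rw [h_eq_countP_admits, ← ncard_eq_countP hn]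
  congr 1
  ext π
  exact (parallelSortable_iff_admits hn π).symm

end SwitchyardSorting

theorem mainTheorem2 (n : ℕ) (hn : 1 ≤ n) :
    SwitchyardSorting.h [] n 0 true = (SwitchyardSorting.dequeClass n).ncard ∧
    SwitchyardSorting.h [] n 0 false = (SwitchyardSorting.parallelClass n).ncard ∧
    SwitchyardSorting.relativisticSortableCount n true =
      (SwitchyardSorting.dequeClass n).ncard ∧
    SwitchyardSorting.relativisticSortableCount n false =
      (SwitchyardSorting.parallelClass n).ncard := by
  rw [SwitchyardSorting.relativisticSortableCount_eq,
    SwitchyardSorting.relativisticSortableCount_eq,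
    SwitchyardSorting.h_eq_ncard_dequeClass hn, SwitchyardSorting.h_eq_ncard_parallelClass hn]
  exact ⟨rfl, rfl, rfl, rfl⟩
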